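/- Let $\mathcal H$ be a separable complex Hilbert space, $\mathcal N$ a bounded self-adjoint operator on $\mathcal H$ with spectrum $\sigma=\sigma(\mathcal N)\subset\mathbb R$, and $\rho$ a density matrix on $\mathcal H$ (a positive operator of trace one). Let $\lambda_\rho$ be the spectral measure of $\mathcal N$ in the state $\rho$, i.e. $\mathrm{tr}(g(\mathcal N)\rho)=\int g\,d\lambda_\rho$ for bounded Borel $g$. Let $\mu$ be a $\sigma$-finite measure on a measurable space $\mathcal X$, and let $V_\xi:\mathbb R\to\mathbb C$, $\xi\in\mathcal X$, be a (jointly) measurable family of bounded functions; write $f(\xi|\nu)=|V_\xi(\nu)|^2$ and suppose $\int_{\mathcal X} f(\xi|\nu)\,d\mu(\xi)=1$ for $\nu\in\sigma$. Put $d\mu_\nu(\xi)=f(\xi|\nu)\,d\mu(\xi)$, let $\mathbb E_\nu$ be the expectation with respect to $\mu_\nu$, and let $l(\nu|\xi)=\log f(\xi|\nu)$. Let $\mathbb P_\rho$ be the probability measure on $\mathcal X^{\mathbb N}$ under which, for every $k$, $(\xi_1,\dots,\xi_k)$ has density $\mathrm{tr}(V_k\rho V_k^*)$ with respect to $\mu^{\otimes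 k}$, where $V_k=V_{\xi_k}(\mathcal N)\cdots V_{\xi_1}(\mathcal N)$. Let $\hat{\mathcal N}_k$ be a maximum likelihood estimator, that is, a measurable choice of a maximiser over $\nu\in\sigma$ of $l_k(\nu)=\frac1k\sum_{j=1}^k l(\nu|\xi_j)$. Assume: (A) for $\nu\neq\nu'$ in $\sigma$ the functions $f(\cdot|\nu)$ and $f(\cdot|\nu')$ are not $\mu$-almost everywhere equal; $f(\xi|\cdot)$ is continuous on $\sigma$ for every $\xi$; and $\sup_{\nu'\in\sigma}|l(\nu'|\cdot)|\in L^1(\mu_\nu)$ for every $\nu\in\sigma$. (B) $f(\xi|\nu)>0$ for all $\xi\in\mathcal X$, $\nu\in\sigma$; $f(\xi|\cdot)$ is twice continuously differentiable on $\mathbb R$ for every $\xi$; and for every $\nu\in\sigma$: there is $g\in L^1(\mu_\nu)$ with $|\partial_\nu^j l(\nu'|\xi)|<g(\xi)$ for $j=1,2$, all $\xi$ and all $\nu'\in\sigma$; $\partial_\nu^j f(\cdot|\nu)\in L^1(\mu)$ and $\int\partial_\nu^j f(\xi|\nu)\,d\mu(\xi)=0$ for $j=1,2$; $\partial_\nu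 l(\nu|\cdot)\in L^2(\mu_\nu)$; and $\mathbb E_\nu[-\partial_\nu^2 l(\nu|\xi)]>0$. (C) the boundary of $\sigma$ in $\mathbb R$ satisfies $\lambda_\rho(\partial\sigma)=0$. Let $F(\nu)=\mathbb E_\nu[(\partial_\nu l(\nu|\xi))^2]$ be the Fisher information. Then $\hat{\mathcal N}_k$ converges $\mathbb P_\rho$-almost surely to a random variable $\hat{\mathcal N}_\infty$ with law $\lambda_\rho$, and, under $\mathbb P_\rho$, $\sqrt k\,(\hat{\mathcal N}_k-\hat{\mathcal N}_\infty)$ converges in distribution, as $k\to\infty$, to the normal law with mean zero and random variance $F(\hat{\mathcal N}_\infty)^{-1}$, i.e. to the mixture $\int_\sigma \mathscr N(0,F(\nu)^{-1})\,d\lambda_\rho(\nu)$. In particular, for every $a\in\mathbb R$, $$\lim_{k\to\infty}\mathbb P_\rho\big(\sqrt k\,(\hat{\mathcal N}_k-\hat{\mathcal N}_\infty)\le a\big)=\int_\sigma \mathscr N(0,F(\nu)^{-1})\big((-\infty,a]\big)\,d\lambda_\rho(\nu).$$ -/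

import Mathlib

open MeasureTheory ProbabilityTheory Filter Topology
open scoped ENNReal NNReal InnerProductSpace CompactlySupported

namespace NonDemolition

noncomputable section

/-! ### Trace, spectral measures and the Borel functional calculus -/

section Operators

variable {H : Type*} [NormedAddCommGroup H] [InnerProductSpace ℂ H] [CompleteSpace H]

/-- An orthonormal (Hilbert) basis of `H`, indexed by a set of vectors of `H`. -/
def stdBasis (H : Type*) [NormedAddCommGroup H] [InnerProductSpace ℂ H] [CompleteSpace H] :
    HilbertBasis (exists_hilbertBasis ℂ H).choose ℂ H :=
  (exists_hilbertBasis ℂ H).choose_spec.choose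

/-- The trace `∑ᵢ ⟨eᵢ, T eᵢ⟩` of an operator. For trace class operators the sum converges
absolutely and does not depend on the orthonormal basis. -/
def trace (T : H →L[ℂ] H) : ℂ := ∑' i, ⟪stdBasis H i, T (stdBasis H i)⟫_ℂ

/-- Density matrices: positive operators of trace one. (An operator with divergent trace sum has
`trace T = 0`, so that such a positive operator is automatically trace class.) -/
structure IsDensityMatrix (ρ : H →L[ℂ] H) : Prop where
  isPositive : ρ.IsPositive
  trace_eq_one : trace ρ = 1

/-- The positive linear functional `g ↦ ⟨ψ, g(N) ψ⟩` on compactly supported continuous functions,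
with `g(N)` given by the continuous functional calculus. -/
def vectorFunctional (N : H →L[ℂ] H) (ψ : H) : C_c(ℝ, ℝ) →ₚ[ℝ] ℝ :=
  PositiveLinearMap.mk₀
    { toFun := fun g => (⟪ψ, cfc (g : ℝ → ℝ) N ψ⟫_ℂ).re
      map_add' := fun g h => by
        have e : cfc (⇑(g + h)) N = cfc (⇑g) N + cfc (⇑h) N :=
          cfc_add (a := N) (⇑g) (⇑h) g.continuous.continuousOn h.continuous.continuousOn
        rw [e]
        simp
      map_smul' := fun c g => by
        have e : cfc (⇑(c • g)) N = c • cfc (⇑g) N :=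
          cfc_smul c (⇑g) N g.continuous.continuousOn
        rw [e]
        simp [inner_smul_right_eq_smul] }
    (fun g hg => by
      have h0 : (0 : H →L[ℂ] H) ≤ cfc (⇑g) N := cfc_nonneg (fun x _ => hg x)
      exact (Complex.le_def.1
        (((ContinuousLinearMap.nonneg_iff_isPositive _).1 h0).inner_nonneg_right ψ)).1)

/-- The spectral measure of `N` in the vector state `ψ`, i.e. the measure `μ_ψ` on `ℝ` with
`∫ g dμ_ψ = ⟨ψ, g(N) ψ⟩` (Riesz–Markov–Kakutani). -/
def vectorSpectralMeasure (N : H →L[ℂ] H) (ψ : H) : Measure ℝ :=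
  RealRMK.rieszMeasure (vectorFunctional N ψ)

/-- `T` is `g(N)` in the sense of the Borel functional calculus:
`⟨ψ, T ψ⟩ = ∫ g dμ_ψ` for all `ψ`. There is at most one such bounded operator `T`, and exactly one
if `N` is self-adjoint and `g` is a bounded Borel function. -/
def IsBorelCalculus (N : H →L[ℂ] H) (g : ℝ → ℂ) (T : H →L[ℂ] H) : Prop :=
  ∀ ψ : H, ⟪ψ, T ψ⟫_ℂ = ∫ ν, g ν ∂(vectorSpectralMeasure N ψ)

open Classical in
/-- The operator `g(N)` (Borel functional calculus). -/
def borelCalculus (N : H →L[ℂ] H) (g : ℝ → ℂ) : H →L[ℂ] H :=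
  if h : ∃ T, IsBorelCalculus N g T then h.choose else 0

/-- `lam` is the spectral measure of `N` with respect to the state `ρ`:
`tr(g(N) ρ) = ∫ g dλ` for all bounded Borel functions `g`. -/
structure IsSpectralMeasure (N ρ : H →L[ℂ] H) (lam : Measure ℝ) : Prop where
  isFinite : IsFiniteMeasure lam
  trace_eq : ∀ g : ℝ → ℂ, Measurable g → (∃ C : ℝ, ∀ ν, ‖g ν‖ ≤ C) →
    trace (borelCalculus N g * ρ) = ∫ ν, g ν ∂lam

open Classical in
/-- The spectral measure `λ_ρ` of `N` with respect to the state `ρ`; it is uniquely determined by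
the defining property `IsSpectralMeasure`. -/
def spectralMeasure (N ρ : H →L[ℂ] H) : Measure ℝ :=
  if h : ∃ lam, IsSpectralMeasure N ρ lam then h.choose else 0

end Operators

/-! ### The law of the measurement outcomes -/

section Outcomes

variable {H : Type*} [NormedAddCommGroup H] [InnerProductSpace ℂ H] [CompleteSpace H]
  {X : Type*} [MeasurableSpace X]

/-- The ordered product `V_{ξ_k} ⋯ V_{ξ_1}` of jump operators. -/
def jumpProd (W : X → H →L[ℂ] H) : (k : ℕ) → (Fin k → X) → H →L[ℂ] H
  | 0, _ => 1
  | k + 1, x => W (x (Fin.last k)) * jumpProd W k (fun i => x i.castSucc)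

/-- `P` is the law on the space of infinite sequences of outcomes whose finite-dimensional
distributions have the densities `tr(V_k ρ V_k^*)` with respect to `μ^{⊗ k}`. -/
def IsOutcomeLaw (μ : Measure X) (W : X → H →L[ℂ] H) (ρ : H →L[ℂ] H)
    (P : Measure (ℕ → X)) : Prop :=
  ∀ (k : ℕ) (E : Set (Fin k → X)), MeasurableSet E →
    P {ω | (fun i : Fin k => ω i) ∈ E} =
      ∫⁻ x in E, ENNReal.ofReal
        (trace (jumpProd W k x * ρ * ContinuousLinearMap.adjoint (jumpProd W k x))).re
        ∂(Measure.pi fun _ : Fin k => μ)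

open Classical in
/-- The measure `ℙ_ρ` on the space of infinite sequences of outcomes, for the jump operators
`V_ξ = V_ξ(N)`; it is uniquely determined by its finite-dimensional distributions. -/
def outcomeLaw (μ : Measure X) (N : H →L[ℂ] H) (V : X → ℝ → ℂ) (ρ : H →L[ℂ] H) :
    Measure (ℕ → X) :=
  if h : ∃ P, IsOutcomeLaw μ (fun ξ => borelCalculus N (V ξ)) ρ P then h.choose else 0

end Outcomes

/-! ### Likelihood and Fisher information -/

section Likelihood

variable {X : Type*} [MeasurableSpace X]

/-- The conditional probability density `f(ξ | ν) = |V_ξ(ν)|²`. -/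
def density (V : X → ℝ → ℂ) (ξ : X) (ν : ℝ) : ℝ := ‖V ξ ν‖ ^ 2

/-- The probability measure `dμ_ν(ξ) = f(ξ | ν) dμ(ξ)`. -/
def condLaw (μ : Measure X) (V : X → ℝ → ℂ) (ν : ℝ) : Measure X :=
  μ.withDensity fun ξ => ENNReal.ofReal (density V ξ ν)

/-- The log-likelihood `l(ν | ξ) = log f(ξ | ν)`, as a function of `ν`. -/
def logLik (V : X → ℝ → ℂ) (ξ : X) (ν : ℝ) : ℝ := Real.log (density V ξ ν)

/-- The log-likelihood `l_k(ν | ω)` of the first `k` outcomes `ω 0, …, ω (k - 1)`. -/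
def logLikAvg (V : X → ℝ → ℂ) (k : ℕ) (ω : ℕ → X) (ν : ℝ) : ℝ :=
  (1 / (k : ℝ)) * ∑ j ∈ Finset.range k, logLik V (ω j) ν

/-- The Fisher information `F(ν) = 𝔼_ν[(∂_ν l(ν | ξ))²]`. -/
def fisher (μ : Measure X) (V : X → ℝ → ℂ) (ν : ℝ) : ℝ :=
  ∫ ξ, (deriv (logLik V ξ) ν) ^ 2 ∂(condLaw μ V ν)

/-- A measurable choice `est k` of maximum likelihood estimators over the parameter set `S`. -/
structure IsMLE (V : X → ℝ → ℂ) (S : Set ℝ) (est : ℕ → (ℕ → X) → ℝ) : Prop where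
  measurable : ∀ k, Measurable (est k)
  mem : ∀ k ω, est k ω ∈ S
  isMax : ∀ k ω, ∀ ν ∈ S, logLikAvg V k ω ν ≤ logLikAvg V k ω (est k ω)

/-- Measurable families of bounded functions `V_ξ`, normalised on the parameter set `S`. -/
structure IsJumpFamily (μ : Measure X) (V : X → ℝ → ℂ) (S : Set ℝ) : Prop where
  measurable : Measurable (Function.uncurry V)
  bounded : ∀ ξ, ∃ C : ℝ, ∀ ν, ‖V ξ ν‖ ≤ C
  normalised : ∀ ν ∈ S, ∫ ξ, density V ξ ν ∂μ = 1

/-- Assumptions for the law of large numbers: integrability, identifiability, continuity and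
dominance. (The logarithm of a vanishing density is not meant here; `CLTAssumption` excludes it.) -/
structure LLNAssumption (μ : Measure X) (V : X → ℝ → ℂ) (S : Set ℝ) : Prop where
  integrable : ∀ ν ∈ S, Integrable (fun ξ => density V ξ ν) μ
  identifiable : ∀ ν ∈ S, ∀ ν' ∈ S, ν ≠ ν' →
    ¬ ((fun ξ => density V ξ ν) =ᵐ[μ] fun ξ => density V ξ ν')
  continuous : ∀ ξ, ContinuousOn (density V ξ) S
  dominated : ∀ ν ∈ S,
    Integrable (fun ξ => ⨆ ν' : S, |logLik V ξ ν'|) (condLaw μ V ν)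

/-- Additional assumptions for the central limit theorem: positivity, `C²` dependence on the
parameter, dominated derivatives of the log-likelihood, differentiation under the integral sign
(the derivatives of the constant `∫ f(ξ | ν) dμ(ξ) = 1` being zero), square-integrable score and
positive information. -/
structure CLTAssumption (μ : Measure X) (V : X → ℝ → ℂ) (S : Set ℝ) : Prop where
  pos : ∀ ν ∈ S, ∀ ξ, 0 < density V ξ ν
  contDiff : ∀ ξ, ContDiff ℝ 2 (density V ξ)
  dominated : ∀ ν ∈ S, ∃ g : X → ℝ, Integrable g (condLaw μ V ν) ∧
    ∀ j ∈ ({1, 2} : Set ℕ), ∀ ξ, ∀ ν' ∈ S, |iteratedDeriv j (logLik V ξ) ν'| < g ξ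
  deriv_integral : ∀ ν ∈ S, ∀ j ∈ ({1, 2} : Set ℕ),
    Integrable (fun ξ => iteratedDeriv j (density V ξ) ν) μ ∧
      ∫ ξ, iteratedDeriv j (density V ξ) ν ∂μ = 0
  score_memLp : ∀ ν ∈ S, MemLp (fun ξ => deriv (logLik V ξ) ν) 2 (condLaw μ V ν)
  info_pos : ∀ ν ∈ S, 0 < ∫ ξ, -iteratedDeriv 2 (logLik V ξ) ν ∂(condLaw μ V ν)

/-- The centred normal law with variance `F(ν)⁻¹`. -/
def limitNormal (μ : Measure X) (V : X → ℝ → ℂ) (ν : ℝ) : Measure ℝ :=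
  gaussianReal 0 (Real.toNNReal (fisher μ V ν)⁻¹)

end Likelihood

end

end NonDemolition

/-!
Given the value `ν` of `N`, the outcomes are independent with law `μ_ν`: for vector states, the
density `tr(V_k ρ V_k^*)` is the integral of `∏ f(ξ_i | ν)` against the spectral measure, so
`ℙ_ρ` is the mixture over `λ_ρ` of the product laws `μ_ν^{⊗ ℕ}`. Under each of these laws the
statement is classical. The uniform law of large numbers on the compact set `σ`, with Gibbs'
inequality to identify the maximiser of the limit, makes the maximum likelihood estimator converge
to `ν`. For `ν` in the interior of `σ` the estimator eventually solves the likelihood equation,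
whose first-order expansion at `ν` combines the central limit theorem for the score with the law of
large numbers for its derivative. Both limits survive integration over `λ_ρ`, which does not charge
the boundary of `σ`.
-/

namespace NonDemolition

noncomputable section

section VectorMeasure

variable {H : Type*} [NormedAddCommGroup H] [InnerProductSpace ℂ H] [CompleteSpace H]

instance instRegularVectorSpectralMeasure (N : H →L[ℂ] H) (ψ : H) :
    (vectorSpectralMeasure N ψ).Regular := by
  unfold vectorSpectralMeasure
  infer_instance

lemma integral_compactlySupported_vectorSpectralMeasure (N : H →L[ℂ] H) (ψ : H) (g : C_c(ℝ, ℝ)) :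
    ∫ ν, g ν ∂(vectorSpectralMeasure N ψ) = (⟪ψ, cfc (g : ℝ → ℝ) N ψ⟫_ℂ).re :=
  RealRMK.integral_rieszMeasure _ _

lemma vectorSpectralMeasure_eq_zero_of_isCompact (N : H →L[ℂ] H) (ψ : H) {K : Set ℝ}
    (hK : IsCompact K) (hKS : Disjoint K (spectrum ℝ N)) : vectorSpectralMeasure N ψ K = 0 := by
  obtain ⟨f, hf1, hf0, hfc, hf⟩ :=
    exists_continuous_one_zero_of_isCompact hK (spectrum.isClosed N) hKS
  have hfN : cfc (f : ℝ → ℝ) N = 0 := by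
    rw [← cfc_zero ℝ N]
    exact cfc_congr hf0
  have hle := RealRMK.rieszMeasure_le_of_eq_one (vectorFunctional N ψ) (f := ⟨f, hfc⟩)
    (fun x => (hf x).1) hK fun x hx => hf1 hx
  change vectorSpectralMeasure N ψ K ≤ ENNReal.ofReal (⟪ψ, cfc (f : ℝ → ℝ) N ψ⟫_ℂ).re at hle
  simpa only [hfN, zero_apply, inner_zero_right, Complex.zero_re, ENNReal.ofReal_zero,
    nonpos_iff_eq_zero] using hle

lemma vectorSpectralMeasure_compl_spectrum (N : H →L[ℂ] H) (ψ : H) :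
    vectorSpectralMeasure N ψ (spectrum ℝ N)ᶜ = 0 := by
  rw [(spectrum.isClosed N).isOpen_compl.measure_eq_iSup_isCompact]
  simp only [ENNReal.iSup_eq_zero]
  exact fun K hKS hK => vectorSpectralMeasure_eq_zero_of_isCompact N ψ hK
    (Set.subset_compl_iff_disjoint_right.1 hKS)

lemma vectorSpectralMeasure_ae_mem_spectrum (N : H →L[ℂ] H) (ψ : H) :
    ∀ᵐ ν ∂(vectorSpectralMeasure N ψ), ν ∈ spectrum ℝ N :=
  mem_ae_iff.2 (vectorSpectralMeasure_compl_spectrum N ψ)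

instance instIsFiniteMeasureVectorSpectralMeasure (N : H →L[ℂ] H) (ψ : H) :
    IsFiniteMeasure (vectorSpectralMeasure N ψ) where
  measure_univ_lt_top := by
    rw [← measure_add_measure_compl (spectrum.isClosed (𝕜 := ℝ) N).measurableSet,
      vectorSpectralMeasure_compl_spectrum, add_zero]
    exact (spectrum.isCompact N).measure_lt_top

lemma integrable_vectorSpectralMeasure (N : H →L[ℂ] H) (ψ : H) {E : Type*}
    [NormedAddCommGroup E] {g : ℝ → E} (hg : Continuous g) :
    Integrable g (vectorSpectralMeasure N ψ) := by
  rw [← Measure.restrict_eq_self_of_ae_mem (vectorSpectralMeasure_ae_mem_spectrum N ψ)]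
  exact hg.continuousOn.integrableOn_compact (spectrum.isCompact N)

lemma integral_vectorSpectralMeasure (N : H →L[ℂ] H) (ψ : H) {g : ℝ → ℝ} (hg : Continuous g) :
    ∫ ν, g ν ∂(vectorSpectralMeasure N ψ) = (⟪ψ, cfc g N ψ⟫_ℂ).re := by
  obtain ⟨χ, hχ, -, hχc, -⟩ := exists_continuous_one_zero_of_isCompact
    (spectrum.isCompact (𝕜 := ℝ) N) (t := (∅ : Set ℝ)) isClosed_empty (Set.disjoint_empty _)
  let g' : C_c(ℝ, ℝ) := ⟨⟨fun x => g x * χ x, hg.mul χ.continuous⟩, hχc.mul_left⟩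
  have hg' : Set.EqOn g g' (spectrum ℝ N) := fun x hx =>
    ((congrArg (g x * ·) (hχ hx)).trans (mul_one (g x))).symm
  rw [cfc_congr hg', ← integral_compactlySupported_vectorSpectralMeasure]
  exact integral_congr_ae ((vectorSpectralMeasure_ae_mem_spectrum N ψ).mono hg')

/-- The operator `c(N)` for a continuous complex function `c` on the real line, taken from the
complex functional calculus of `N`. -/
def contCalc (N : H →L[ℂ] H) (c : ℝ → ℂ) : H →L[ℂ] H := cfc (fun z : ℂ => c z.re) N

lemma inner_cfc_eq_integral (N : H →L[ℂ] H) (ψ : H) {g : ℝ → ℝ} (hg : Continuous g) :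
    ⟪ψ, cfc g N ψ⟫_ℂ = ∫ ν, (g ν : ℂ) ∂(vectorSpectralMeasure N ψ) := by
  have hsa : IsSelfAdjoint (cfc g N) := cfc_predicate g N
  rw [integral_complex_ofReal, integral_vectorSpectralMeasure N ψ hg]
  exact ((ContinuousLinearMap.isSelfAdjoint_iff_isSymmetric.1 hsa).coe_re_inner_self_apply ψ).symm

variable {N : H →L[ℂ] H}

lemma contCalc_eq_re_add_im (hN : IsSelfAdjoint N) {c : ℝ → ℂ} (hc : Continuous c) :
    contCalc N c = cfc (fun x => (c x).re) N + Complex.I • cfc (fun x => (c x).im) N := by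
  rw [cfc_real_eq_complex _ hN, cfc_real_eq_complex _ hN, ← cfc_smul (R := ℂ) .., ← cfc_add ..]
  exact cfc_congr fun z _ => by simp [mul_comm Complex.I, Complex.re_add_im]

lemma inner_contCalc (hN : IsSelfAdjoint N) (ψ : H) {c : ℝ → ℂ} (hc : Continuous c) :
    ⟪ψ, contCalc N c ψ⟫_ℂ = ∫ ν, c ν ∂(vectorSpectralMeasure N ψ) := by
  have hre : Continuous fun x => (c x).re := by fun_prop
  have him : Continuous fun x => (c x).im := by fun_prop
  rw [contCalc_eq_re_add_im hN hc, add_apply, smul_apply, inner_add_right, inner_smul_right,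
    inner_cfc_eq_integral N ψ hre, inner_cfc_eq_integral N ψ him,
    ← integral_re_add_im (integrable_vectorSpectralMeasure N ψ hc)]
  simp only [RCLike.re_to_complex, RCLike.im_to_complex, integral_complex_ofReal, mul_comm]
  rfl

lemma contCalc_sub {a b : ℝ → ℂ} (ha : Continuous a) (hb : Continuous b) :
    contCalc N (a - b) = contCalc N a - contCalc N b :=
  cfc_sub ..

lemma contCalc_mul {a b : ℝ → ℂ} (ha : Continuous a) (hb : Continuous b) :
    contCalc N (a * b) = contCalc N a * contCalc N b :=
  cfc_mul ..

lemma contCalc_star (N : H →L[ℂ] H) (c : ℝ → ℂ) : contCalc N (star c) = star (contCalc N c) :=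
  cfc_star ..

lemma norm_contCalc_le {c : ℝ → ℂ} {C : ℝ} (hC : ∀ x, ‖c x‖ ≤ C) : ‖contCalc N c‖ ≤ C :=
  norm_cfc_le ((norm_nonneg _).trans (hC 0)) fun _ _ => hC _

lemma inner_contCalc_contCalc (hN : IsSelfAdjoint N) (ψ : H) {a b : ℝ → ℂ}
    (ha : Continuous a) (hb : Continuous b) :
    ⟪contCalc N a ψ, contCalc N b ψ⟫_ℂ = ∫ ν, star (a ν) * b ν ∂(vectorSpectralMeasure N ψ) := by
  have hsa : Continuous (star a) := ha.star
  refine Eq.trans ?_ (inner_contCalc hN ψ (c := star a * b) (hsa.mul hb))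
  rw [contCalc_mul hsa hb, contCalc_star, ContinuousLinearMap.star_eq_adjoint,
    mul_apply_eq_comp, ContinuousLinearMap.adjoint_inner_right]

lemma norm_sq_contCalc (hN : IsSelfAdjoint N) (ψ : H) {c : ℝ → ℂ} (hc : Continuous c) :
    ‖contCalc N c ψ‖ ^ 2 = ∫ ν, ‖c ν‖ ^ 2 ∂(vectorSpectralMeasure N ψ) := by
  have h := inner_contCalc_contCalc hN ψ hc hc
  simp only [inner_self_eq_norm_sq_to_K, RCLike.star_def, RCLike.conj_mul] at h
  rw [← Complex.ofReal_inj, ← integral_complex_ofReal]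
  simp only [Complex.ofReal_pow]
  exact h

lemma vectorSpectralMeasure_univ (hN : IsSelfAdjoint N) (ψ : H) :
    vectorSpectralMeasure N ψ Set.univ = ‖ψ‖ₑ ^ 2 := by
  have h := norm_sq_contCalc hN ψ (c := 1) continuous_one
  have hone : contCalc N 1 = 1 := cfc_one ℂ N
  simp only [hone, one_apply_eq_self, Pi.one_apply, norm_one, one_pow, integral_const,
    smul_eq_mul, mul_one] at h
  rw [← ofReal_measureReal, ← h, ENNReal.ofReal_pow (norm_nonneg ψ), ofReal_norm]

lemma integral_vectorSpectralMeasure_contCalc (hN : IsSelfAdjoint N) (ψ : H) {c : ℝ → ℂ}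
    (hc : Continuous c) {h : ℝ → ℝ} (hh : Continuous h) :
    ∫ ν, h ν ∂(vectorSpectralMeasure N (contCalc N c ψ)) =
      ∫ ν, ‖c ν‖ ^ 2 * h ν ∂(vectorSpectralMeasure N ψ) := by
  have hh' : Continuous fun ν => (h ν : ℂ) := by fun_prop
  rw [← Complex.ofReal_inj, ← integral_complex_ofReal, ← integral_complex_ofReal,
    ← inner_contCalc hN _ hh', ← mul_apply_eq_comp, ← contCalc_mul hh' hc,
    inner_contCalc_contCalc hN ψ hc (hh'.mul hc)]
  refine integral_congr_ae (ae_of_all _ fun ν => ?_)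
  simp only [Pi.mul_apply, RCLike.star_def, Complex.ofReal_mul, Complex.ofReal_pow]
  rw [mul_left_comm, Complex.conj_mul', mul_comm]

lemma tendsto_integral_vectorSpectralMeasure (N : H →L[ℂ] H) {ι : Type*} {l : Filter ι}
    {φ : ι → H} {ψ : H} (hφ : Tendsto φ l (𝓝 ψ)) {h : ℝ → ℝ} (hh : Continuous h) :
    Tendsto (fun i => ∫ ν, h ν ∂(vectorSpectralMeasure N (φ i))) l
      (𝓝 (∫ ν, h ν ∂(vectorSpectralMeasure N ψ))) := by
  simp only [integral_vectorSpectralMeasure N _ hh]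
  have hcont : Continuous fun ψ : H => (⟪ψ, cfc h N ψ⟫_ℂ).re := by fun_prop
  exact (hcont.tendsto ψ).comp hφ

end VectorMeasure

section BoundedApproximation

/-- Bounded approximation of `g`: the functions `c i` are continuous, uniformly bounded by `C`, and
converge to `g` almost everywhere along the filter `l`. It carries identities of the continuous
functional calculus over to bounded Borel functions. -/
structure IsBoundedApprox {ι : Type*} (m : Measure ℝ) (l : Filter ι) (C : ℝ) (c : ι → ℝ → ℂ)
    (g : ℝ → ℂ) : Prop where
  continuous : ∀ i, Continuous (c i)
  norm_le : ∀ i x, ‖c i x‖ ≤ C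
  tendsto_ae : ∀ᵐ x ∂m, Tendsto (fun i => c i x) l (𝓝 (g x))

variable {ι κ : Type*} {m m' : Measure ℝ} {l : Filter ι} {l' : Filter κ} {C C' : ℝ}
  {c c' : ι → ℝ → ℂ} {g g' : ℝ → ℂ}

lemma IsBoundedApprox.comp (h : IsBoundedApprox m l C c g) {φ : κ → ι} (hφ : Tendsto φ l' l) :
    IsBoundedApprox m l' C (fun k => c (φ k)) g where
  continuous k := h.continuous (φ k)
  norm_le k := h.norm_le (φ k)
  tendsto_ae := h.tendsto_ae.mono fun _ hx => hx.comp hφ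

lemma IsBoundedApprox.sub (h : IsBoundedApprox m l C c g) (h' : IsBoundedApprox m l C' c' g') :
    IsBoundedApprox m l (C + C') (fun i => c i - c' i) (g - g') where
  continuous i := (h.continuous i).sub (h'.continuous i)
  norm_le i x := (norm_sub_le _ _).trans (add_le_add (h.norm_le i x) (h'.norm_le i x))
  tendsto_ae := by
    filter_upwards [h.tendsto_ae, h'.tendsto_ae] with x hx hx' using hx.sub hx'

lemma IsBoundedApprox.mono_measure (h : IsBoundedApprox m l C c g) (hm : m' ≤ m) :
    IsBoundedApprox m' l C c g :=
  ⟨h.continuous, h.norm_le, ae_mono hm h.tendsto_ae⟩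

lemma IsBoundedApprox.tendsto_integral [IsFiniteMeasure m] [l.IsCountablyGenerated]
    (h : IsBoundedApprox m l C c g) {E : Type*} [NormedAddCommGroup E] [NormedSpace ℝ E]
    {Φ : ℝ → ℂ → E} (hΦ : Continuous (Function.uncurry Φ)) {M : ℝ}
    (hM : ∀ x z, ‖z‖ ≤ C → ‖Φ x z‖ ≤ M) :
    Tendsto (fun i => ∫ x, Φ x (c i x) ∂m) l (𝓝 (∫ x, Φ x (g x) ∂m)) := by
  refine tendsto_integral_filter_of_dominated_convergence (fun _ => M)
    (Eventually.of_forall fun i => ?_)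
    (Eventually.of_forall fun i => ae_of_all _ fun x => hM x _ (h.norm_le i x))
    (integrable_const M) ?_
  · exact (hΦ.comp (continuous_id.prodMk (h.continuous i))).aestronglyMeasurable
  · filter_upwards [h.tendsto_ae] with x hx
    exact ((hΦ.comp (Continuous.prodMk_right x)).tendsto (g x)).comp hx

lemma exists_continuous_retraction_closedBall {C : ℝ} (hC : 0 ≤ C) :
    ∃ r : C(ℂ, ℂ), (∀ z, ‖r z‖ ≤ C) ∧ ∀ z, ‖z‖ ≤ C → r z = z := by
  rcases hC.eq_or_lt with rfl | hpos
  · exact ⟨0, fun z => by simp, fun z hz => (norm_le_zero_iff.1 hz).symm⟩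
  have : TietzeExtension (Metric.closedBall (0 : ℂ) C) :=
    Metric.instTietzeExtensionClosedBall ℂ 0 hpos
  obtain ⟨r, hr, hrid⟩ := ContinuousMap.exists_forall_mem_restrict_eq Metric.isClosed_closedBall
    (f := (⟨Subtype.val, continuous_subtype_val⟩ : C(Metric.closedBall (0 : ℂ) C, ℂ)))
    (t := Metric.closedBall 0 C) fun z => z.2
  exact ⟨r, fun z => mem_closedBall_zero_iff.1 (hr z), fun z hz =>
    DFunLike.congr_fun hrid (⟨z, mem_closedBall_zero_iff.2 hz⟩ : Metric.closedBall (0 : ℂ) C)⟩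

lemma exists_continuous_seq_tendsto_ae {α E : Type*} [NormedAddCommGroup E] [NormedSpace ℝ E]
    [TopologicalSpace α] [NormalSpace α] [SecondCountableTopologyEither α E]
    [MeasurableSpace α] [BorelSpace α] {m : Measure α} [m.WeaklyRegular] [IsFiniteMeasure m]
    {g : α → E} (hg : Integrable g m) :
    ∃ a : ℕ → α → E, (∀ n, Continuous (a n)) ∧
      ∀ᵐ x ∂m, Tendsto (fun n => a n x) atTop (𝓝 (g x)) := by
  have happrox (n : ℕ) : ∃ a : BoundedContinuousFunction α E,
      eLpNorm (g - (a : α → E)) 1 m ≤ (n : ℝ≥0∞)⁻¹ ∧ MemLp a 1 m :=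
    (memLp_one_iff_integrable.2 hg).exists_boundedContinuous_eLpNorm_sub_le ENNReal.one_ne_top
      (ENNReal.inv_ne_zero.2 (ENNReal.natCast_ne_top n))
  choose a ha _ using happrox
  have hL1 : Tendsto (fun n => eLpNorm (⇑(a n) - g) 1 m) atTop (𝓝 0) :=
    tendsto_of_tendsto_of_tendsto_of_le_of_le tendsto_const_nhds
      ENNReal.tendsto_inv_nat_nhds_zero (fun _ => zero_le) fun n =>
        (eLpNorm_sub_comm _ _ _ _).trans_le (ha n)
  obtain ⟨ns, -, hns⟩ := (tendstoInMeasure_of_tendsto_eLpNorm one_ne_zero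
    (fun n => (a n).continuous.aestronglyMeasurable) hg.aestronglyMeasurable
    hL1).exists_seq_tendsto_ae
  exact ⟨fun n => a (ns n), fun n => (a (ns n)).continuous, hns⟩

lemma exists_isBoundedApprox (m : Measure ℝ) [IsFiniteMeasure m] (hg : Measurable g)
    (hC : ∀ x, ‖g x‖ ≤ C) :
    ∃ c : ℕ → ℝ → ℂ, IsBoundedApprox m atTop C c g := by
  obtain ⟨a, ha, hlim⟩ := exists_continuous_seq_tendsto_ae
    (Integrable.of_bound hg.aestronglyMeasurable C (ae_of_all m hC))
  obtain ⟨r, hrC, hrid⟩ := exists_continuous_retraction_closedBall ((norm_nonneg _).trans (hC 0))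
  refine ⟨fun n x => r (a n x), fun n => r.continuous.comp (ha n), fun n x => hrC _, ?_⟩
  filter_upwards [hlim] with x hx
  simpa only [hrid _ (hC x), Function.comp_def] using (r.continuous.tendsto (g x)).comp hx

end BoundedApproximation

section BorelCalculus

variable {H : Type*} [NormedAddCommGroup H] [InnerProductSpace ℂ H] [CompleteSpace H]
  {N : H →L[ℂ] H} {g : ℝ → ℂ} {C : ℝ}

lemma IsBoundedApprox.tendsto_contCalc_zero (hN : IsSelfAdjoint N) {ι : Type*} {l : Filter ι}
    [l.IsCountablyGenerated] {c : ι → ℝ → ℂ} {ψ : H}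
    (h : IsBoundedApprox (vectorSpectralMeasure N ψ) l C c 0) :
    Tendsto (fun i => contCalc N (c i) ψ) l (𝓝 0) := by
  have hsq := h.tendsto_integral (Φ := fun _ z => ‖z‖ ^ 2) (by fun_prop) (M := C ^ 2)
    fun _ z hz => by simpa using pow_le_pow_left₀ (norm_nonneg z) hz 2
  simp only [← norm_sq_contCalc hN ψ (h.continuous _)] at hsq
  simpa [tendsto_zero_iff_norm_tendsto_zero] using hsq.sqrt

/-- `χ = g(N) ψ`, in the sense that `c n (N) ψ → χ` for all bounded approximations `c` of `g` by
sequences. -/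
def IsBorelLimit (N : H →L[ℂ] H) (g : ℝ → ℂ) (ψ χ : H) : Prop :=
  ∀ (C : ℝ) (c : ℕ → ℝ → ℂ), IsBoundedApprox (vectorSpectralMeasure N ψ) atTop C c g →
    Tendsto (fun n => contCalc N (c n) ψ) atTop (𝓝 χ)

lemma IsBoundedApprox.isBorelLimit (hN : IsSelfAdjoint N) {a : ℕ → ℝ → ℂ} {ψ χ : H}
    (ha : IsBoundedApprox (vectorSpectralMeasure N ψ) atTop C a g)
    (hχ : Tendsto (fun n => contCalc N (a n) ψ) atTop (𝓝 χ)) : IsBorelLimit N g ψ χ := by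
  intro C' c hc
  have hdiff := hc.sub ha
  rw [sub_self] at hdiff
  have hzero := hdiff.tendsto_contCalc_zero hN
  simp only [contCalc_sub (hc.continuous _) (ha.continuous _)] at hzero
  simpa using hzero.add hχ

lemma exists_isBorelLimit (hN : IsSelfAdjoint N) (hg : Measurable g)
    (hC : ∀ x, ‖g x‖ ≤ C) (ψ : H) : ∃ χ, IsBorelLimit N g ψ χ := by
  obtain ⟨a, ha⟩ := exists_isBoundedApprox (vectorSpectralMeasure N ψ) hg hC
  have hdiff := (ha.comp tendsto_fst).sub (ha.comp (l' := atTop ×ˢ atTop) tendsto_snd)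
  rw [sub_self, prod_atTop_atTop_eq] at hdiff
  have hzero := hdiff.tendsto_contCalc_zero hN
  simp only [contCalc_sub (ha.continuous _) (ha.continuous _)] at hzero
  have hcauchy : CauchySeq fun n => contCalc N (a n) ψ := by
    rw [cauchySeq_iff_tendsto_dist_atTop_0]
    simpa [dist_eq_norm] using hzero.norm
  obtain ⟨χ, hχ⟩ := cauchySeq_tendsto_of_complete hcauchy
  exact ⟨χ, ha.isBorelLimit hN hχ⟩

lemma IsBorelLimit.add (hg : Measurable g) (hC : ∀ x, ‖g x‖ ≤ C)
    {φ ψ χ χ' χ'' : H} (hφ : IsBorelLimit N g φ χ) (hψ : IsBorelLimit N g ψ χ')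
    (h : IsBorelLimit N g (φ + ψ) χ'') : χ'' = χ + χ' := by
  obtain ⟨a, ha⟩ := exists_isBoundedApprox (vectorSpectralMeasure N φ +
    (vectorSpectralMeasure N ψ + vectorSpectralMeasure N (φ + ψ))) hg hC
  have hrest := ha.mono_measure (Measure.le_add_left le_rfl)
  have hlim := h C a (hrest.mono_measure (Measure.le_add_left le_rfl))
  simp only [map_add] at hlim
  exact tendsto_nhds_unique hlim
    ((hφ C a (ha.mono_measure (Measure.le_add_right le_rfl))).add
      (hψ C a (hrest.mono_measure (Measure.le_add_right le_rfl))))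

lemma IsBorelLimit.smul (hg : Measurable g) (hC : ∀ x, ‖g x‖ ≤ C) {z : ℂ}
    {ψ χ χ' : H} (hψ : IsBorelLimit N g ψ χ) (h : IsBorelLimit N g (z • ψ) χ') : χ' = z • χ := by
  obtain ⟨a, ha⟩ := exists_isBoundedApprox
    (vectorSpectralMeasure N ψ + vectorSpectralMeasure N (z • ψ)) hg hC
  have hlim := h C a (ha.mono_measure (Measure.le_add_left le_rfl))
  simp only [map_smul] at hlim
  exact tendsto_nhds_unique hlim
    ((hψ C a (ha.mono_measure (Measure.le_add_right le_rfl))).const_smul z)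

lemma IsBorelLimit.norm_le (hg : Measurable g) (hC : ∀ x, ‖g x‖ ≤ C) {ψ χ : H}
    (h : IsBorelLimit N g ψ χ) : ‖χ‖ ≤ C * ‖ψ‖ := by
  obtain ⟨a, ha⟩ := exists_isBoundedApprox (vectorSpectralMeasure N ψ) hg hC
  exact le_of_tendsto (h C a ha).norm (Eventually.of_forall fun n =>
    ContinuousLinearMap.le_of_opNorm_le _ (norm_contCalc_le (ha.norm_le n)) ψ)

lemma exists_forall_isBorelLimit (hN : IsSelfAdjoint N) (hg : Measurable g)
    (hC : ∀ x, ‖g x‖ ≤ C) : ∃ T : H →L[ℂ] H, ∀ ψ, IsBorelLimit N g ψ (T ψ) := by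
  choose T hT using exists_isBorelLimit hN hg hC
  let L : H →ₗ[ℂ] H :=
    { toFun := T
      map_add' := fun φ ψ => (hT φ).add hg hC (hT ψ) (hT (φ + ψ))
      map_smul' := fun z ψ => (hT ψ).smul hg hC (hT (z • ψ)) }
  exact ⟨L.mkContinuous C fun ψ => (hT ψ).norm_le hg hC, hT⟩

lemma isBorelCalculus_of_isBorelLimit (hN : IsSelfAdjoint N) (hg : Measurable g)
    (hC : ∀ x, ‖g x‖ ≤ C) {T : H →L[ℂ] H} (hT : ∀ ψ, IsBorelLimit N g ψ (T ψ)) :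
    IsBorelCalculus N g T := by
  intro ψ
  obtain ⟨a, ha⟩ := exists_isBoundedApprox (vectorSpectralMeasure N ψ) hg hC
  have hlim : Tendsto (fun n => ⟪ψ, contCalc N (a n) ψ⟫_ℂ) atTop (𝓝 ⟪ψ, T ψ⟫_ℂ) :=
    tendsto_const_nhds.inner (hT ψ C a ha)
  simp only [inner_contCalc hN ψ (ha.continuous _)] at hlim
  exact tendsto_nhds_unique hlim
    (ha.tendsto_integral (Φ := fun _ z => z) (by fun_prop) fun _ _ hz => hz)

lemma IsBorelCalculus.unique {S T : H →L[ℂ] H} (hS : IsBorelCalculus N g S)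
    (hT : IsBorelCalculus N g T) : S = T := by
  refine ContinuousLinearMap.coe_injective ((ext_inner_map _ _).1 fun ψ => ?_)
  rw [← inner_conj_symm, ← inner_conj_symm ((T : H →ₗ[ℂ] H) ψ)]
  exact congrArg _ ((hS ψ).trans (hT ψ).symm)

lemma isBorelLimit_borelCalculus (hN : IsSelfAdjoint N) (hg : Measurable g)
    (hb : ∃ C, ∀ x, ‖g x‖ ≤ C) (ψ : H) : IsBorelLimit N g ψ (borelCalculus N g ψ) := by
  obtain ⟨C, hC⟩ := hb
  obtain ⟨T, hT⟩ := exists_forall_isBorelLimit hN hg hC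
  have hTg := isBorelCalculus_of_isBorelLimit hN hg hC hT
  have hex : ∃ T, IsBorelCalculus N g T := ⟨T, hTg⟩
  rw [borelCalculus, dif_pos hex, hex.choose_spec.unique hTg]
  exact hT ψ

lemma isBorelCalculus_borelCalculus (hN : IsSelfAdjoint N) (hg : Measurable g)
    (hb : ∃ C, ∀ x, ‖g x‖ ≤ C) : IsBorelCalculus N g (borelCalculus N g) := by
  obtain ⟨C, hC⟩ := hb
  exact isBorelCalculus_of_isBorelLimit hN hg hC
    (isBorelLimit_borelCalculus hN hg ⟨C, hC⟩)

lemma integral_vectorSpectralMeasure_borelCalculus (hN : IsSelfAdjoint N) (hg : Measurable g)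
    (hb : ∃ C, ∀ x, ‖g x‖ ≤ C) (ψ : H) (h : C_c(ℝ, ℝ)) :
    ∫ ν, h ν ∂(vectorSpectralMeasure N (borelCalculus N g ψ)) =
      ∫ ν, ‖g ν‖ ^ 2 * h ν ∂(vectorSpectralMeasure N ψ) := by
  obtain ⟨C, hC⟩ := hb
  obtain ⟨M, hM⟩ := h.hasCompactSupport.exists_bound_of_continuous h.continuous
  obtain ⟨a, ha⟩ := exists_isBoundedApprox (vectorSpectralMeasure N ψ) hg hC
  have hlim := tendsto_integral_vectorSpectralMeasure N
    (isBorelLimit_borelCalculus hN hg ⟨C, hC⟩ ψ C a ha) h.continuous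
  simp only [integral_vectorSpectralMeasure_contCalc hN ψ (ha.continuous _) h.continuous] at hlim
  have hΦ : Continuous fun p : ℝ × ℂ => ‖p.2‖ ^ 2 * h p.1 := by
    have := h.continuous
    fun_prop
  refine tendsto_nhds_unique hlim (ha.tendsto_integral (Φ := fun ν z => ‖z‖ ^ 2 * h ν) hΦ
    (M := C ^ 2 * M) fun ν z hz => ?_)
  rw [norm_mul, norm_pow, norm_norm]
  exact mul_le_mul (pow_le_pow_left₀ (norm_nonneg z) hz 2) (hM ν) (norm_nonneg _) (sq_nonneg C)

lemma vectorSpectralMeasure_borelCalculus (hN : IsSelfAdjoint N) (hg : Measurable g)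
    (hb : ∃ C, ∀ x, ‖g x‖ ≤ C) (ψ : H) :
    vectorSpectralMeasure N (borelCalculus N g ψ) =
      (vectorSpectralMeasure N ψ).withDensity fun ν => ENNReal.ofReal (‖g ν‖ ^ 2) := by
  have hfin : IsFiniteMeasure
      ((vectorSpectralMeasure N ψ).withDensity fun ν => ENNReal.ofReal (‖g ν‖ ^ 2)) := by
    obtain ⟨C, hC⟩ := hb
    exact isFiniteMeasure_withDensity_ofReal (HasFiniteIntegral.of_bounded (C := C ^ 2)
      (ae_of_all _ fun x => by simpa using pow_le_pow_left₀ (norm_nonneg _) (hC x) 2))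
  refine Measure.ext_of_integral_eq_on_compactlySupported fun h => ?_
  rw [integral_vectorSpectralMeasure_borelCalculus hN hg hb,
    integral_withDensity_eq_integral_toReal_smul (by fun_prop) (ae_of_all _ fun x => by simp)]
  simp only [ENNReal.toReal_ofReal (sq_nonneg _), smul_eq_mul]

end BorelCalculus

section Trace

lemma enorm_sq_eq_tsum_inner {H : Type*} [NormedAddCommGroup H] [InnerProductSpace ℂ H]
    {ι : Type*} (b : HilbertBasis ι ℂ H) (x : H) :
    ‖x‖ₑ ^ 2 = ∑' i, ‖⟪b i, x⟫_ℂ‖ₑ ^ 2 := by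
  have hinner : ∀ i, ⟪x, b i⟫_ℂ * ⟪b i, x⟫_ℂ = ((‖⟪b i, x⟫_ℂ‖ ^ 2 : ℝ) : ℂ) := fun i => by
    rw [← inner_conj_symm x (b i), Complex.conj_mul']
    simp
  have hparseval : HasSum (fun i => ‖⟪b i, x⟫_ℂ‖ ^ 2) (‖x‖ ^ 2) := by
    have h := b.hasSum_inner_mul_inner x x
    rw [inner_self_eq_norm_sq_to_K] at h
    simp only [hinner] at h
    exact Complex.hasSum_ofReal.1 (by simpa using h)
  have h := ENNReal.ofReal_tsum_of_nonneg (fun i => by positivity) hparseval.summable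
  rw [hparseval.tsum_eq] at h
  simpa [ENNReal.ofReal_pow] using h

variable {H : Type*} [NormedAddCommGroup H] [InnerProductSpace ℂ H] [CompleteSpace H]

/-- The squared Hilbert–Schmidt norm `tr(A^* A)` of an operator, possibly infinite, computed in
the basis `stdBasis H`. -/
def hilbertSchmidtSq (A : H →L[ℂ] H) : ℝ≥0∞ := ∑' i, ‖A (stdBasis H i)‖ₑ ^ 2

lemma hilbertSchmidtSq_adjoint (A : H →L[ℂ] H) :
    hilbertSchmidtSq (ContinuousLinearMap.adjoint A) = hilbertSchmidtSq A := by
  simp only [hilbertSchmidtSq, enorm_sq_eq_tsum_inner (stdBasis H),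
    ContinuousLinearMap.adjoint_inner_right]
  rw [ENNReal.tsum_comm]
  refine tsum_congr fun i => tsum_congr fun j => ?_
  rw [← ofReal_norm, ← ofReal_norm, norm_inner_symm]

lemma hilbertSchmidtSq_mul_le (A B : H →L[ℂ] H) :
    hilbertSchmidtSq (A * B) ≤ ‖A‖ₑ ^ 2 * hilbertSchmidtSq B := by
  rw [hilbertSchmidtSq, hilbertSchmidtSq, ← ENNReal.tsum_mul_left]
  refine ENNReal.tsum_le_tsum fun i => ?_
  rw [← mul_pow]
  exact pow_le_pow_left' (A.le_opENorm _) 2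

lemma summable_norm_matrix_sq {A : H →L[ℂ] H} (hA : hilbertSchmidtSq A ≠ ∞) :
    Summable fun p : _ × _ => ‖⟪stdBasis H p.1, A (stdBasis H p.2)⟫_ℂ‖ ^ 2 := by
  have h : ∑' p : _ × _, ‖⟪stdBasis H p.1, A (stdBasis H p.2)⟫_ℂ‖ₑ ^ 2 ≠ ∞ := by
    rw [ENNReal.tsum_prod (f := fun i j => ‖⟪stdBasis H i, A (stdBasis H j)⟫_ℂ‖ₑ ^ 2),
      ENNReal.tsum_comm]
    simpa only [hilbertSchmidtSq, enorm_sq_eq_tsum_inner (stdBasis H)] using hA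
  simpa using ENNReal.summable_toReal h

lemma inner_mul_eq_tsum (A B : H →L[ℂ] H) (x y : H) :
    ⟪x, (A * B) y⟫_ℂ = ∑' j, ⟪x, A (stdBasis H j)⟫_ℂ * ⟪stdBasis H j, B y⟫_ℂ := by
  simp only [mul_apply_eq_comp, ← ContinuousLinearMap.adjoint_inner_left A,
    (stdBasis H).tsum_inner_mul_inner]

lemma trace_mul_comm {A B : H →L[ℂ] H} (hA : hilbertSchmidtSq A ≠ ∞)
    (hB : hilbertSchmidtSq B ≠ ∞) : trace (A * B) = trace (B * A) := by
  set b := stdBasis H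
  have hsummable :
      Summable (Function.uncurry fun i j => ⟪b i, A (b j)⟫_ℂ * ⟪b j, B (b i)⟫_ℂ) := by
    refine Summable.of_norm_bounded
      ((summable_norm_matrix_sq hA).add (summable_norm_matrix_sq hB).prod_symm) fun p => ?_
    simp only [Function.uncurry, norm_mul, Prod.fst_swap, Prod.snd_swap]
    nlinarith [sq_nonneg (‖⟪b p.1, A (b p.2)⟫_ℂ‖ - ‖⟪b p.2, B (b p.1)⟫_ℂ‖),
      sq_nonneg ‖⟪b p.1, A (b p.2)⟫_ℂ‖, sq_nonneg ‖⟪b p.2, B (b p.1)⟫_ℂ‖]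
  simp only [trace, inner_mul_eq_tsum]
  refine hsummable.tsum_comm.symm.trans ?_
  exact tsum_congr fun i => tsum_congr fun j => mul_comm _ _

lemma trace_adjoint_mul_self (A : H →L[ℂ] H) :
    trace (ContinuousLinearMap.adjoint A * A) = ((∑' i, ‖A (stdBasis H i)‖ ^ 2 : ℝ) : ℂ) := by
  rw [trace, Complex.ofReal_tsum]
  refine tsum_congr fun i => ?_
  rw [mul_apply_eq_comp, ContinuousLinearMap.adjoint_inner_right, inner_self_eq_norm_sq_to_K]
  simp

lemma ofReal_tsum_norm_sq {A : H →L[ℂ] H} (hA : Summable fun i => ‖A (stdBasis H i)‖ ^ 2) :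
    ENNReal.ofReal (∑' i, ‖A (stdBasis H i)‖ ^ 2) = hilbertSchmidtSq A := by
  rw [ENNReal.ofReal_tsum_of_nonneg (fun i => by positivity) hA, hilbertSchmidtSq]
  simp only [ENNReal.ofReal_pow (norm_nonneg _), ofReal_norm]

lemma ofReal_trace_mul_adjoint_self {A : H →L[ℂ] H} (hA : hilbertSchmidtSq A ≠ ∞) :
    ENNReal.ofReal (trace (A * ContinuousLinearMap.adjoint A)).re = hilbertSchmidtSq A := by
  have hsummable : Summable fun i => ‖A (stdBasis H i)‖ ^ 2 := by
    simpa using ENNReal.summable_toReal hA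
  rw [trace_mul_comm hA (by rwa [hilbertSchmidtSq_adjoint]), trace_adjoint_mul_self,
    Complex.ofReal_re, ofReal_tsum_norm_sq hsummable]

end Trace

section DensityMatrix

variable {H : Type*} [NormedAddCommGroup H] [InnerProductSpace ℂ H] [CompleteSpace H]
  {N ρ : H →L[ℂ] H}

lemma adjoint_sqrt (ρ : H →L[ℂ] H) :
    ContinuousLinearMap.adjoint (CFC.sqrt ρ) = CFC.sqrt ρ :=
  (IsSelfAdjoint.of_nonneg (CFC.sqrt_nonneg ρ)).star_eq

lemma IsDensityMatrix.sqrt_mul_sqrt (hρ : IsDensityMatrix ρ) : CFC.sqrt ρ * CFC.sqrt ρ = ρ :=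
  CFC.sqrt_mul_sqrt_self ρ ((ContinuousLinearMap.nonneg_iff_isPositive _).2 hρ.isPositive)

lemma IsDensityMatrix.hilbertSchmidtSq_sqrt (hρ : IsDensityMatrix ρ) :
    hilbertSchmidtSq (CFC.sqrt ρ) = 1 := by
  have htsum : ∑' i, ‖CFC.sqrt ρ (stdBasis H i)‖ ^ 2 = 1 := by
    have h := trace_adjoint_mul_self (CFC.sqrt ρ)
    rw [adjoint_sqrt, hρ.sqrt_mul_sqrt, hρ.trace_eq_one] at h
    exact_mod_cast h.symm
  have hsummable : Summable fun i => ‖CFC.sqrt ρ (stdBasis H i)‖ ^ 2 :=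
    not_imp_comm.1 tsum_eq_zero_of_not_summable (by simp [htsum])
  rw [← ofReal_tsum_norm_sq hsummable, htsum, ENNReal.ofReal_one]

lemma IsDensityMatrix.hilbertSchmidtSq_mul_sqrt_ne_top (hρ : IsDensityMatrix ρ)
    (A : H →L[ℂ] H) : hilbertSchmidtSq (A * CFC.sqrt ρ) ≠ ∞ := by
  refine ne_top_of_le_ne_top ?_ (hilbertSchmidtSq_mul_le A (CFC.sqrt ρ))
  rw [hρ.hilbertSchmidtSq_sqrt, mul_one]
  exact ENNReal.pow_ne_top enorm_ne_top

lemma IsDensityMatrix.trace_mul (hρ : IsDensityMatrix ρ) (T : H →L[ℂ] H) :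
    trace (T * ρ) = ∑' i, ⟪CFC.sqrt ρ (stdBasis H i), T (CFC.sqrt ρ (stdBasis H i))⟫_ℂ := by
  have hsqrt : hilbertSchmidtSq (CFC.sqrt ρ) ≠ ∞ := by simp [hρ.hilbertSchmidtSq_sqrt]
  calc trace (T * ρ) = trace ((T * CFC.sqrt ρ) * CFC.sqrt ρ) := by
        rw [mul_assoc, hρ.sqrt_mul_sqrt]
    _ = trace (CFC.sqrt ρ * (T * CFC.sqrt ρ)) :=
        trace_mul_comm (hρ.hilbertSchmidtSq_mul_sqrt_ne_top T) hsqrt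
    _ = _ := tsum_congr fun i => by
        rw [mul_apply_eq_comp, ← ContinuousLinearMap.adjoint_inner_left, adjoint_sqrt,
          mul_apply_eq_comp]

lemma IsDensityMatrix.ofReal_trace_conj (hρ : IsDensityMatrix ρ) (A : H →L[ℂ] H) :
    ENNReal.ofReal (trace (A * ρ * ContinuousLinearMap.adjoint A)).re =
      ∑' i, ‖A (CFC.sqrt ρ (stdBasis H i))‖ₑ ^ 2 := by
  have hfactor : A * ρ * ContinuousLinearMap.adjoint A =
      (A * CFC.sqrt ρ) * ContinuousLinearMap.adjoint (A * CFC.sqrt ρ) := by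
    rw [← ContinuousLinearMap.star_eq_adjoint, ← ContinuousLinearMap.star_eq_adjoint, star_mul,
      ContinuousLinearMap.star_eq_adjoint (CFC.sqrt ρ), adjoint_sqrt, ← mul_assoc,
      mul_assoc A (CFC.sqrt ρ), hρ.sqrt_mul_sqrt]
  rw [hfactor, ofReal_trace_mul_adjoint_self (hρ.hilbertSchmidtSq_mul_sqrt_ne_top A)]
  rfl

/-- The measure `∑ᵢ μ_{√ρ eᵢ}`, which turns out to be the spectral measure of `N` in the state
`ρ`. -/
def sumSpectralMeasure (N ρ : H →L[ℂ] H) : Measure ℝ :=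
  Measure.sum fun i => vectorSpectralMeasure N (CFC.sqrt ρ (stdBasis H i))

lemma sumSpectralMeasure_univ (hN : IsSelfAdjoint N) (hρ : IsDensityMatrix ρ) :
    sumSpectralMeasure N ρ Set.univ = 1 := by
  simp only [sumSpectralMeasure, Measure.sum_apply _ MeasurableSet.univ,
    vectorSpectralMeasure_univ hN]
  exact hρ.hilbertSchmidtSq_sqrt

lemma isSpectralMeasure_sum (hN : IsSelfAdjoint N) (hρ : IsDensityMatrix ρ) :
    IsSpectralMeasure N ρ (sumSpectralMeasure N ρ) := by
  have hfinite : IsFiniteMeasure (sumSpectralMeasure N ρ) :=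
    ⟨by rw [sumSpectralMeasure_univ hN hρ]; exact ENNReal.one_lt_top⟩
  refine ⟨hfinite, fun g hg ⟨C, hC⟩ => ?_⟩
  have hint : Integrable g (sumSpectralMeasure N ρ) :=
    Integrable.of_bound hg.aestronglyMeasurable C (ae_of_all _ hC)
  rw [hρ.trace_mul]
  simp only [isBorelCalculus_borelCalculus hN hg ⟨C, hC⟩ _]
  exact (hasSum_integral_measure hint).tsum_eq

lemma IsSpectralMeasure.unique {m m' : Measure ℝ} (h : IsSpectralMeasure N ρ m)
    (h' : IsSpectralMeasure N ρ m') : m = m' := by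
  have := h.isFinite
  have := h'.isFinite
  ext s hs
  rw [← measureReal_eq_measureReal_iff]
  have hg : Measurable (s.indicator fun _ => (1 : ℂ)) := measurable_const.indicator hs
  have hb : ∃ C : ℝ, ∀ ν, ‖s.indicator (fun _ => (1 : ℂ)) ν‖ ≤ C :=
    ⟨1, fun ν => (norm_indicator_le_norm_self _ _).trans (by simp)⟩
  have htrace := (h.trace_eq _ hg hb).symm.trans (h'.trace_eq _ hg hb)
  simpa [integral_indicator_const _ hs] using htrace

lemma spectralMeasure_eq_sum (hN : IsSelfAdjoint N) (hρ : IsDensityMatrix ρ) :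
    spectralMeasure N ρ = sumSpectralMeasure N ρ := by
  have hex : ∃ m, IsSpectralMeasure N ρ m := ⟨_, isSpectralMeasure_sum hN hρ⟩
  rw [spectralMeasure, dif_pos hex]
  exact hex.choose_spec.unique (isSpectralMeasure_sum hN hρ)

lemma isProbabilityMeasure_spectralMeasure (hN : IsSelfAdjoint N) (hρ : IsDensityMatrix ρ) :
    IsProbabilityMeasure (spectralMeasure N ρ) :=
  ⟨by rw [spectralMeasure_eq_sum hN hρ, sumSpectralMeasure_univ hN hρ]⟩

lemma spectralMeasure_ae_mem (hN : IsSelfAdjoint N) (hρ : IsDensityMatrix ρ) :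
    ∀ᵐ ν ∂(spectralMeasure N ρ), ν ∈ spectrum ℝ N := by
  rw [spectralMeasure_eq_sum hN hρ, sumSpectralMeasure]
  exact (Measure.ae_sum_iff' (spectrum.isClosed (𝕜 := ℝ) N).measurableSet).2 fun i =>
    vectorSpectralMeasure_ae_mem_spectrum N _

end DensityMatrix

section ProductMeasures

lemma lintegral_prod_pi {k : ℕ} {X : Fin k → Type*} [∀ i, MeasurableSpace (X i)]
    (μ : ∀ i, Measure (X i)) [∀ i, SigmaFinite (μ i)] {f : ∀ i, X i → ℝ≥0∞}
    (hf : ∀ i, Measurable (f i)) :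
    ∫⁻ x, ∏ i, f i (x i) ∂(Measure.pi μ) = ∏ i, ∫⁻ ξ, f i ξ ∂(μ i) := by
  induction k with
  | zero => simp
  | succ k ih =>
    rw [← (measurePreserving_piFinSuccAbove μ 0).symm.lintegral_comp_emb
        (MeasurableEquiv.measurableEmbedding _),
      lintegral_prod _ (by fun_prop), Fin.prod_univ_succ,
      ← ih (fun i => μ i.succ) fun i => hf i.succ, ← lintegral_mul_const _ (hf 0)]
    refine lintegral_congr fun ξ => ?_
    simp only [Fin.prod_univ_succ]
    exact lintegral_const_mul (f 0 ξ) (f := fun y : ∀ i : Fin k, X i.succ => ∏ i, f i.succ (y i))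
      (Finset.measurable_fun_prod _ fun i _ => (hf _).comp (measurable_pi_apply i))

lemma indicator_univ_pi_prod {ι : Type*} [Fintype ι] {X : ι → Type*} (s : ∀ i, Set (X i))
    (f : ∀ i, X i → ℝ≥0∞) (x : ∀ i, X i) :
    (Set.univ.pi s).indicator (fun x => ∏ i, f i (x i)) x = ∏ i, (s i).indicator (f i) (x i) := by
  by_cases hx : x ∈ Set.univ.pi s
  · rw [Set.indicator_of_mem hx]
    exact Finset.prod_congr rfl fun i _ => (Set.indicator_of_mem (hx i trivial) (f i)).symm
  · obtain ⟨i, hi⟩ : ∃ i, x i ∉ s i := by simpa [Set.mem_pi] using hx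
    rw [Set.indicator_of_notMem hx]
    exact (Finset.prod_eq_zero (Finset.mem_univ i) (Set.indicator_of_notMem hi (f i))).symm

lemma pi_withDensity {k : ℕ} {X : Fin k → Type*} [∀ i, MeasurableSpace (X i)]
    (μ : ∀ i, Measure (X i)) [∀ i, SigmaFinite (μ i)] {f : ∀ i, X i → ℝ≥0∞}
    (hf : ∀ i, Measurable (f i)) [∀ i, SigmaFinite ((μ i).withDensity (f i))] :
    Measure.pi (fun i => (μ i).withDensity (f i)) =
      (Measure.pi μ).withDensity fun x => ∏ i, f i (x i) := by
  refine Measure.pi_eq fun s hs => ?_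
  have hbox : MeasurableSet (Set.univ.pi s) := MeasurableSet.univ_pi hs
  rw [withDensity_apply _ hbox, ← lintegral_indicator hbox]
  simp only [indicator_univ_pi_prod]
  rw [lintegral_prod_pi μ fun i => (hf i).indicator (hs i)]
  refine Finset.prod_congr rfl fun i _ => ?_
  rw [lintegral_indicator (hs i), withDensity_apply _ (hs i)]

variable {X : Type*} [MeasurableSpace X]

/-- The law of a sequence of independent outcomes with common law `Q`. It is the zero measure if
`Q` is not a probability measure, so that no such assumption is needed to form it. -/
def iidLaw (Q : Measure X) : Measure (ℕ → X) := Measure.infinitePi fun _ : ℕ => Q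

instance instIsProbabilityMeasureIidLaw (Q : Measure X) [IsProbabilityMeasure Q] :
    IsProbabilityMeasure (iidLaw Q) :=
  inferInstanceAs (IsProbabilityMeasure (Measure.infinitePi fun _ : ℕ => Q))

lemma iidLaw_of_not_isProbabilityMeasure {Q : Measure X} (hQ : ¬ IsProbabilityMeasure Q) :
    iidLaw Q = 0 := by
  rw [iidLaw, Measure.infinitePi, dif_neg (by simpa using hQ)]

lemma measurable_iidLaw_comp {α : Type*} [MeasurableSpace α] {Q : α → Measure X}
    [∀ a, IsProbabilityMeasure (Q a)] (hQ : Measurable Q) : Measurable fun a => iidLaw (Q a) := by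
  refine Measurable.measure_of_isPiSystem_of_isProbabilityMeasure
    (generateFrom_squareCylinders (α := fun _ : ℕ => X)).symm
    (isPiSystem_squareCylinders (fun _ => MeasurableSpace.isPiSystem_measurableSet)
      (fun _ => MeasurableSet.univ)) ?_
  rintro _ ⟨s, t, ht, rfl⟩
  have ht' : ∀ i, MeasurableSet (t i) := fun i => ht i trivial
  simp only [iidLaw, Measure.infinitePi_pi (fun _ : ℕ => Q _) (fun i _ => ht' i)]
  exact Finset.measurable_fun_prod _ fun i _ => (Measure.measurable_coe (ht' i)).comp hQ

lemma measurable_iidLaw : Measurable (iidLaw : Measure X → Measure (ℕ → X)) := by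
  have hs : MeasurableSet {Q : Measure X | IsProbabilityMeasure Q} := by
    simp only [isProbabilityMeasure_iff]
    exact Measure.measurable_coe MeasurableSet.univ (measurableSet_singleton 1)
  refine measurable_of_restrict_of_restrict_compl hs ?_ ?_
  · have (Q : {Q : Measure X | IsProbabilityMeasure Q}) : IsProbabilityMeasure (Q : Measure X) :=
      Q.2
    exact measurable_iidLaw_comp measurable_subtype_coe
  · have hzero : {Q : Measure X | IsProbabilityMeasure Q}ᶜ.domRestrict iidLaw =
        fun _ => (0 : Measure (ℕ → X)) :=
      funext fun Q => iidLaw_of_not_isProbabilityMeasure Q.2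
    rw [hzero]
    exact measurable_const

lemma iidLaw_map_initial (Q : Measure X) [IsProbabilityMeasure Q] (k : ℕ) :
    (iidLaw Q).map (fun ω (i : Fin k) => ω i) = Measure.pi fun _ : Fin k => Q := by
  rw [← Measure.infinitePi_eq_pi]
  exact Measure.map_infinitePi_infinitePi_of_inj Fin.val_injective

end ProductMeasures

section JumpProducts

variable {H : Type*} [NormedAddCommGroup H] [InnerProductSpace ℂ H] [CompleteSpace H]
  {X : Type*} {V : X → ℝ → ℂ} {N ρ : H →L[ℂ] H}

lemma vectorSpectralMeasure_jumpProd (hN : IsSelfAdjoint N) (hV : ∀ ξ, Measurable (V ξ))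
    (hb : ∀ ξ, ∃ C : ℝ, ∀ ν, ‖V ξ ν‖ ≤ C) (k : ℕ) (x : Fin k → X) (ψ : H) :
    vectorSpectralMeasure N (jumpProd (fun ξ => borelCalculus N (V ξ)) k x ψ) =
      (vectorSpectralMeasure N ψ).withDensity fun ν =>
        ∏ i, ENNReal.ofReal (density V (x i) ν) := by
  have hdensity : ∀ ξ, Measurable fun ν => ENNReal.ofReal (density V ξ ν) := fun ξ =>
    ((hV ξ).norm.pow_const 2).ennreal_ofReal
  induction k with
  | zero => simp [jumpProd]
  | succ k ih =>
    simp only [jumpProd, mul_apply_eq_comp, Fin.prod_univ_castSucc]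
    rw [vectorSpectralMeasure_borelCalculus hN (hV _) (hb _), ih fun i => x i.castSucc]
    exact (withDensity_mul₀ (Finset.measurable_fun_prod _ fun i _ => hdensity _).aemeasurable
      (hdensity _).aemeasurable).symm

lemma ofReal_trace_jumpProd (hN : IsSelfAdjoint N) (hρ : IsDensityMatrix ρ)
    (hV : ∀ ξ, Measurable (V ξ)) (hb : ∀ ξ, ∃ C : ℝ, ∀ ν, ‖V ξ ν‖ ≤ C) (k : ℕ) (x : Fin k → X) :
    ENNReal.ofReal (trace (jumpProd (fun ξ => borelCalculus N (V ξ)) k x * ρ *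
      ContinuousLinearMap.adjoint (jumpProd (fun ξ => borelCalculus N (V ξ)) k x))).re =
      ∫⁻ ν, ∏ i, ENNReal.ofReal (density V (x i) ν) ∂(spectralMeasure N ρ) := by
  rw [hρ.ofReal_trace_conj, spectralMeasure_eq_sum hN hρ, sumSpectralMeasure,
    lintegral_sum_measure]
  refine tsum_congr fun i => ?_
  rw [← vectorSpectralMeasure_univ hN, vectorSpectralMeasure_jumpProd hN hV hb,
    withDensity_apply _ MeasurableSet.univ, Measure.restrict_univ]

end JumpProducts

section OutcomeLaw

variable {H : Type*} [NormedAddCommGroup H] [InnerProductSpace ℂ H] [CompleteSpace H]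
  {X : Type*} [MeasurableSpace X] {μ : Measure X} {V : X → ℝ → ℂ} {S : Set ℝ} {ν : ℝ}
  {N ρ : H →L[ℂ] H}

lemma IsOutcomeLaw.unique {W : X → H →L[ℂ] H} {P P' : Measure (ℕ → X)} [IsFiniteMeasure P]
    (h : IsOutcomeLaw μ W ρ P) (h' : IsOutcomeLaw μ W ρ P') : P' = P := by
  refine IsProjectiveLimit.unique (P := fun I => P.map I.restrict) (fun I => ?_) (fun I => rfl)
  obtain ⟨k, hk⟩ : ∃ k, I ⊆ Finset.range k := ⟨I.sup id + 1, fun i hi =>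
    Finset.mem_range.2 (Nat.lt_succ_of_le (Finset.le_sup (f := id) hi))⟩
  ext E hE
  have hm : Measurable fun (x : Fin k → X) (i : I) =>
      x ⟨i, Finset.mem_range.1 (hk i.2)⟩ := by fun_prop
  rw [Measure.map_apply (by fun_prop) hE, Measure.map_apply (by fun_prop) hE]
  exact (h' k _ (hm hE)).trans (h k _ (hm hE)).symm

lemma measurable_density (hV : Measurable (Function.uncurry V)) :
    Measurable (Function.uncurry (density V)) :=
  hV.norm.pow_const 2

lemma IsJumpFamily.measurable_apply (hV : IsJumpFamily μ V S) (ξ : X) : Measurable (V ξ) :=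
  hV.measurable.comp measurable_prodMk_left

lemma IsJumpFamily.measurable_density_left (hV : IsJumpFamily μ V S) (ν : ℝ) :
    Measurable fun ξ => density V ξ ν :=
  (measurable_density hV.measurable).comp measurable_prodMk_right

lemma measurable_condLaw [SFinite μ] (hV : Measurable (Function.uncurry V)) :
    Measurable (condLaw μ V) := by
  refine Measure.measurable_of_measurable_coe _ fun s hs => ?_
  simp only [condLaw, withDensity_apply _ hs]
  exact (measurable_density hV).ennreal_ofReal.lintegral_prod_left'

lemma measurable_iidLaw_condLaw [SFinite μ] (hV : Measurable (Function.uncurry V)) :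
    Measurable fun ν => iidLaw (condLaw μ V ν) :=
  measurable_iidLaw.comp (measurable_condLaw hV)

lemma IsJumpFamily.isProbabilityMeasure_condLaw (hV : IsJumpFamily μ V S) (hν : ν ∈ S) :
    IsProbabilityMeasure (condLaw μ V ν) := by
  have hint : Integrable (fun ξ => density V ξ ν) μ :=
    not_imp_comm.1 integral_undef (by simp [hV.normalised ν hν])
  refine ⟨?_⟩
  rw [condLaw, withDensity_apply _ MeasurableSet.univ, Measure.restrict_univ,
    ← ofReal_integral_eq_lintegral_ofReal hint (ae_of_all _ fun ξ => sq_nonneg ‖V ξ ν‖),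
    hV.normalised ν hν, ENNReal.ofReal_one]

lemma IsJumpFamily.isProbabilityMeasure_bind_iidLaw [SFinite μ] (hV : IsJumpFamily μ V S)
    {m : Measure ℝ} [IsProbabilityMeasure m] (hm : ∀ᵐ ν ∂m, ν ∈ S) :
    IsProbabilityMeasure (m.bind fun ν => iidLaw (condLaw μ V ν)) := by
  refine isProbabilityMeasure_bind (measurable_iidLaw_condLaw hV.measurable).aemeasurable ?_
  filter_upwards [hm] with ν hν
  have := hV.isProbabilityMeasure_condLaw hν
  infer_instance

lemma IsJumpFamily.sigmaFinite (hV : IsJumpFamily μ V S) (hν : ν ∈ S)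
    (hpos : ∀ ξ, 0 < density V ξ ν) : SigmaFinite μ := by
  have := hV.isProbabilityMeasure_condLaw hν
  have hinv := withDensity_inv_same (μ := μ) (hV.measurable_density_left ν).ennreal_ofReal
    (ae_of_all _ fun ξ => (ENNReal.ofReal_pos.2 (hpos ξ)).ne')
    (ae_of_all _ fun ξ => ENNReal.ofReal_ne_top)
  rw [← hinv]
  change SigmaFinite ((condLaw μ V ν).withDensity _)
  exact SigmaFinite.withDensity_of_ne_top (ae_of_all _ fun ξ =>
    ENNReal.inv_ne_top.2 (ENNReal.ofReal_pos.2 (hpos ξ)).ne')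

lemma iidLaw_condLaw_initial [SigmaFinite μ] (hV : IsJumpFamily μ V S) (hν : ν ∈ S) (k : ℕ)
    {E : Set (Fin k → X)} (hE : MeasurableSet E) :
    iidLaw (condLaw μ V ν) {ω | (fun i : Fin k => ω i) ∈ E} =
      ∫⁻ x in E, ∏ i, ENNReal.ofReal (density V (x i) ν) ∂(Measure.pi fun _ : Fin k => μ) := by
  have := hV.isProbabilityMeasure_condLaw hν
  have : SigmaFinite (μ.withDensity fun ξ => ENNReal.ofReal (density V ξ ν)) :=
    inferInstanceAs (SigmaFinite (condLaw μ V ν))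
  calc iidLaw (condLaw μ V ν) {ω | (fun i : Fin k => ω i) ∈ E}
      = (iidLaw (condLaw μ V ν)).map (fun ω (i : Fin k) => ω i) E :=
        (Measure.map_apply (by fun_prop) hE).symm
    _ = Measure.pi (fun _ : Fin k => μ.withDensity fun ξ => ENNReal.ofReal (density V ξ ν)) E := by
        rw [iidLaw_map_initial]
        rfl
    _ = _ := by
        rw [pi_withDensity (fun _ : Fin k => μ) fun _ =>
          (hV.measurable_density_left ν).ennreal_ofReal, withDensity_apply _ hE]

lemma isOutcomeLaw_bind [SigmaFinite μ] (hN : IsSelfAdjoint N) (hρ : IsDensityMatrix ρ)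
    (hV : IsJumpFamily μ V (spectrum ℝ N)) :
    IsOutcomeLaw μ (fun ξ => borelCalculus N (V ξ)) ρ
      ((spectralMeasure N ρ).bind fun ν => iidLaw (condLaw μ V ν)) := by
  have := isProbabilityMeasure_spectralMeasure hN hρ
  intro k E hE
  have hcyl : MeasurableSet {ω : ℕ → X | (fun i : Fin k => ω i) ∈ E} :=
    (show Measurable fun (ω : ℕ → X) (i : Fin k) => ω i by fun_prop) hE
  have hmeas : Measurable fun p : (Fin k → X) × ℝ =>
      ∏ i, ENNReal.ofReal (density V (p.1 i) p.2) := by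
    refine Finset.measurable_fun_prod _ fun i _ => Measurable.ennreal_ofReal ?_
    have hi : Measurable fun p : (Fin k → X) × ℝ => (p.1 i, p.2) := by fun_prop
    exact (measurable_density hV.measurable).comp hi
  simp only [ofReal_trace_jumpProd hN hρ hV.measurable_apply hV.bounded]
  rw [Measure.bind_apply hcyl (measurable_iidLaw_condLaw hV.measurable).aemeasurable,
    lintegral_lintegral_swap hmeas.aemeasurable]
  refine lintegral_congr_ae ?_
  filter_upwards [spectralMeasure_ae_mem hN hρ] with ν hν
  exact iidLaw_condLaw_initial hV hν k hE

lemma outcomeLaw_eq_bind [SigmaFinite μ] (hN : IsSelfAdjoint N) (hρ : IsDensityMatrix ρ)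
    (hV : IsJumpFamily μ V (spectrum ℝ N)) :
    outcomeLaw μ N V ρ = (spectralMeasure N ρ).bind fun ν => iidLaw (condLaw μ V ν) := by
  have := isProbabilityMeasure_spectralMeasure hN hρ
  have hlaw := isOutcomeLaw_bind hN hρ hV
  have := hV.isProbabilityMeasure_bind_iidLaw (spectralMeasure_ae_mem hN hρ)
  have hex : ∃ P, IsOutcomeLaw μ (fun ξ => borelCalculus N (V ξ)) ρ P := ⟨_, hlaw⟩
  rw [outcomeLaw, dif_pos hex]
  exact hlaw.unique hex.choose_spec

end OutcomeLaw

section LawOfLargeNumbers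

variable {X : Type*} [MeasurableSpace X] {Q : Measure X}

lemma continuousOn_integral_of_bound {T : Type*} [TopologicalSpace T] [FirstCountableTopology T]
    {S : Set T} {h : X → T → ℝ} (hm : ∀ t ∈ S, Measurable fun ξ => h ξ t)
    (hc : ∀ ξ, ContinuousOn (h ξ) S) {g : X → ℝ} (hg : Integrable g Q)
    (hb : ∀ ξ, ∀ t ∈ S, |h ξ t| ≤ g ξ) : ContinuousOn (fun t => ∫ ξ, h ξ t ∂Q) S :=
  continuousOn_of_dominated (fun t ht => (hm t ht).aestronglyMeasurable)
    (fun t ht => ae_of_all _ fun ξ => hb ξ t ht) hg (ae_of_all _ hc)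

variable [IsProbabilityMeasure Q]

lemma iIndepFun_iidLaw {E : Type*} [MeasurableSpace E] {h : X → E} (hm : Measurable h) :
    iIndepFun (fun (i : ℕ) (ω : ℕ → X) => h (ω i)) (iidLaw Q) :=
  iIndepFun_infinitePi (X := fun _ => h) fun _ => hm

lemma identDistrib_iidLaw {E : Type*} [MeasurableSpace E] {h : X → E} (hm : Measurable h)
    (i : ℕ) : IdentDistrib (fun ω : ℕ → X => h (ω i)) h (iidLaw Q) Q where
  aemeasurable_fst := (hm.comp (measurable_pi_apply i)).aemeasurable
  aemeasurable_snd := hm.aemeasurable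
  map_eq := (Measure.map_map hm (measurable_pi_apply i)).symm.trans
    (congrArg (Measure.map h) (Measure.infinitePi_map_eval (fun _ : ℕ => Q) i))

lemma tendsto_average_ae {E : Type*} [NormedAddCommGroup E] [NormedSpace ℝ E] [CompleteSpace E]
    [MeasurableSpace E] [BorelSpace E] {h : X → E} (hm : Measurable h) (hi : Integrable h Q) :
    ∀ᵐ ω ∂(iidLaw Q), Tendsto (fun k : ℕ => (k : ℝ)⁻¹ • ∑ j ∈ Finset.range k, h (ω j)) atTop
      (𝓝 (∫ ξ, h ξ ∂Q)) := by
  have hlaw := identDistrib_iidLaw (Q := Q) hm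
  rw [← (hlaw 0).integral_eq]
  exact strong_law_ae (fun (i : ℕ) (ω : ℕ → X) => h (ω i)) ((hlaw 0).integrable_iff.2 hi)
    (fun i j hij => (iIndepFun_iidLaw hm).indepFun hij) fun i => (hlaw i).trans (hlaw 0).symm

lemma measurable_continuousMap_of_eval {T : Type*} [TopologicalSpace T] [CompactSpace T]
    [T2Space T] [SecondCountableTopology T] [MeasurableSpace C(T, ℝ)] [BorelSpace C(T, ℝ)]
    {h : X → C(T, ℝ)}
    (hm : ∀ t, Measurable fun ξ => h ξ t) : Measurable h := by
  obtain ⟨D, hDc, hD⟩ := TopologicalSpace.exists_countable_dense T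
  have : Countable D := hDc.to_subtype
  -- By the Lusin–Souslin theorem restriction to `D` is a measurable embedding.
  have hrestrict : MeasurableEmbedding fun (f : C(T, ℝ)) (t : D) => f t := by
    refine Continuous.measurableEmbedding (by fun_prop) fun f f' hff' => ?_
    exact DFunLike.coe_injective (f.continuous.ext_on hD f'.continuous fun t ht =>
      congrFun hff' ⟨t, ht⟩)
  exact hrestrict.measurable_comp_iff.1 (measurable_pi_lambda _ fun t => hm t)

/-- The empirical mean of `h` over the first `k` outcomes; it is zero for `k = 0`. -/
def sampleMean (h : X → ℝ) (k : ℕ) (ω : ℕ → X) : ℝ :=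
  (1 / (k : ℝ)) * ∑ j ∈ Finset.range k, h (ω j)

lemma tendstoUniformly_sampleMean_ae {T : Type*} [TopologicalSpace T] [CompactSpace T]
    [T2Space T] [SecondCountableTopology T] {h : X → C(T, ℝ)} (hm : ∀ t, Measurable fun ξ => h ξ t)
    {g : X → ℝ} (hg : Integrable g Q) (hb : ∀ ξ t, |h ξ t| ≤ g ξ) :
    ∀ᵐ ω ∂(iidLaw Q), TendstoUniformly (fun k t => sampleMean (fun ξ => h ξ t) k ω)
      (fun t => ∫ ξ, h ξ t ∂Q) atTop := by
  borelize C(T, ℝ)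
  have hmeas := measurable_continuousMap_of_eval hm
  have hint : Integrable h Q := ⟨hmeas.aestronglyMeasurable,
    ContinuousMap.hasFiniteIntegral_of_bound h g hg.hasFiniteIntegral
      (ae_of_all _ hb)⟩
  filter_upwards [tendsto_average_ae hmeas hint] with ω hω
  have hunif := ContinuousMap.tendsto_iff_tendstoUniformly.1 hω
  simpa [sampleMean, ← ContinuousMap.integral_apply hint] using hunif

lemma tendstoUniformlyOn_sampleMean_ae {T : Type*} [TopologicalSpace T] [T2Space T]
    [SecondCountableTopology T] {S : Set T} (hS : IsCompact S) {h : X → T → ℝ}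
    (hm : ∀ t ∈ S, Measurable fun ξ => h ξ t) (hc : ∀ ξ, ContinuousOn (h ξ) S) {g : X → ℝ}
    (hg : Integrable g Q) (hb : ∀ ξ, ∀ t ∈ S, |h ξ t| ≤ g ξ) :
    ∀ᵐ ω ∂(iidLaw Q), TendstoUniformlyOn (fun k t => sampleMean (fun ξ => h ξ t) k ω)
      (fun t => ∫ ξ, h ξ t ∂Q) atTop S := by
  have : CompactSpace S := isCompact_iff_compactSpace.1 hS
  filter_upwards [tendstoUniformly_sampleMean_ae
    (h := fun ξ => (⟨S.domRestrict (h ξ), (hc ξ).domRestrict⟩ : C(S, ℝ)))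
    (fun t => hm t t.2) hg fun ξ t => hb ξ t t.2] with ω hω
  exact tendstoUniformlyOn_iff_tendstoUniformly_comp_coe.2 hω

lemma tendsto_sampleMean_comp_ae {T : Type*} [TopologicalSpace T] [T2Space T]
    [SecondCountableTopology T] {S : Set T} (hS : IsCompact S) {h : X → T → ℝ}
    (hm : ∀ t ∈ S, Measurable fun ξ => h ξ t) (hc : ∀ ξ, ContinuousOn (h ξ) S) {g : X → ℝ}
    (hg : Integrable g Q) (hb : ∀ ξ, ∀ t ∈ S, |h ξ t| ≤ g ξ) {a : T} (ha : a ∈ S) :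
    ∀ᵐ ω ∂(iidLaw Q), ∀ c : ℕ → T, Tendsto c atTop (𝓝[S] a) →
      Tendsto (fun k => sampleMean (fun ξ => h ξ (c k)) k ω) atTop (𝓝 (∫ ξ, h ξ a ∂Q)) := by
  filter_upwards [tendstoUniformlyOn_sampleMean_ae hS hm hc hg hb] with ω hω c hca
  exact hω.tendsto_comp (continuousOn_integral_of_bound hm hc hg hb a ha) hca

end LawOfLargeNumbers

section Argmax

lemma tendsto_of_tendstoUniformlyOn_of_isStrictMax {α ι : Type*} [TopologicalSpace α]
    {l : Filter ι} {S : Set α} (hS : IsCompact S) {F : ι → α → ℝ} {G : α → ℝ}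
    (hFG : TendstoUniformlyOn F G l S) (hG : ContinuousOn G S) {a : α} (ha : a ∈ S)
    (hmax : ∀ b ∈ S, b ≠ a → G b < G a) {x : ι → α} (hxS : ∀ i, x i ∈ S)
    (hx : ∀ i, F i a ≤ F i (x i)) : Tendsto x l (𝓝 a) := by
  have hGx : ∀ ε > 0, ∀ᶠ i in l, G a - ε < G (x i) := fun ε hε => by
    filter_upwards [Metric.tendstoUniformlyOn_iff.1 hFG (ε / 2) (half_pos hε)] with i hi
    have hia := (abs_lt.1 (Real.dist_eq _ _ ▸ hi a ha)).2
    have hix := (abs_lt.1 (Real.dist_eq _ _ ▸ hi (x i) (hxS i))).1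
    linarith [hx i]
  refine tendsto_nhds.2 fun U hU haU => ?_
  rcases (S \ U).eq_empty_or_nonempty with hempty | hne
  · exact Eventually.of_forall fun i => Set.sdiff_eq_empty.1 hempty (hxS i)
  · obtain ⟨b, hb, hbmax⟩ := (hS.diff hU).exists_isMaxOn hne (hG.mono Set.sdiff_subset)
    have hlt : G b < G a := hmax b hb.1 fun h => hb.2 (h ▸ haU)
    filter_upwards [hGx (G a - G b) (sub_pos.2 hlt)] with i hi
    by_contra hcon
    have hle : G (x i) ≤ G b := hbmax ⟨hxS i, hcon⟩
    linarith

end Argmax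

section Gibbs

lemma integral_log_neg {X : Type*} [MeasurableSpace X] {Q : Measure X} [IsProbabilityMeasure Q]
    {r : X → ℝ} (hpos : ∀ ξ, 0 < r ξ) (hr : Integrable r Q)
    (hlog : Integrable (fun ξ => Real.log (r ξ)) Q) (hone : ∫ ξ, r ξ ∂Q = 1)
    (hne : ¬ ∀ᵐ ξ ∂Q, r ξ = 1) : ∫ ξ, Real.log (r ξ) ∂Q < 0 := by
  have hr1 : Integrable (fun ξ => r ξ - 1) Q := hr.sub (integrable_const 1)
  have hle : ∀ ξ, Real.log (r ξ) ≤ r ξ - 1 := fun ξ => Real.log_le_sub_one_of_pos (hpos ξ)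
  have hint1 : ∫ ξ, (r ξ - 1) ∂Q = 0 := by simp [integral_sub hr (integrable_const 1), hone]
  refine (integral_mono hlog hr1 hle).trans_eq hint1 |>.lt_of_ne fun heq => hne ?_
  have hae := (integral_eq_iff_of_ae_le hlog hr1 (ae_of_all _ hle)).1 (heq.trans hint1.symm)
  filter_upwards [hae] with ξ hξ
  by_contra hcon
  exact (Real.log_lt_sub_one_of_pos (hpos ξ) hcon).ne hξ

end Gibbs

section Derivatives

variable {X : Type*} [MeasurableSpace X]

lemma measurable_deriv_param {F : X → ℝ → ℝ} (hF : Measurable (Function.uncurry F))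
    (hd : ∀ ξ, Differentiable ℝ (F ξ)) :
    Measurable (Function.uncurry fun ξ ν => deriv (F ξ) ν) := by
  refine measurable_of_tendsto_metrizable (f := fun (n : ℕ) (p : X × ℝ) =>
    ((1 / ((n : ℝ) + 1)))⁻¹ • (F p.1 (p.2 + 1 / ((n : ℝ) + 1)) - F p.1 p.2)) (fun n => ?_) ?_
  · have h1 : Measurable fun p : X × ℝ => F p.1 (p.2 + 1 / ((n : ℝ) + 1)) :=
      hF.comp (g := Function.uncurry F)
        (show Measurable fun p : X × ℝ => (p.1, p.2 + 1 / ((n : ℝ) + 1)) by fun_prop)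
    exact (h1.sub hF).const_smul ((1 / ((n : ℝ) + 1))⁻¹)
  · refine tendsto_pi_nhds.2 fun p => ?_
    have h := hasDerivAt_iff_tendsto_slope_zero.1 (hd p.1 p.2).hasDerivAt
    refine h.comp (tendsto_nhdsWithin_iff.2 ⟨tendsto_one_div_add_atTop_nhds_zero_nat, ?_⟩)
    exact Eventually.of_forall fun n => by
      simp only [Set.mem_compl_iff, Set.mem_singleton_iff]
      positivity

variable {μ : Measure X} {V : X → ℝ → ℂ} {S : Set ℝ}

lemma CLTAssumption.differentiable_density (h : CLTAssumption μ V S) (ξ : X) :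
    Differentiable ℝ (density V ξ) := (h.contDiff ξ).differentiable (by norm_num)

lemma CLTAssumption.differentiable_deriv_density (h : CLTAssumption μ V S) (ξ : X) :
    Differentiable ℝ (deriv (density V ξ)) :=
  (contDiff_succ_iff_deriv.1 (show ContDiff ℝ (1 + 1) (density V ξ) from
    (by simpa [one_add_one_eq_two] using h.contDiff ξ))).2.2.differentiable (by norm_num)

lemma CLTAssumption.eventually_pos (h : CLTAssumption μ V S) (ξ : X) {ν : ℝ} (hν : ν ∈ S) :
    ∀ᶠ ν' in 𝓝 ν, 0 < density V ξ ν' :=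
  (h.differentiable_density ξ).continuous.continuousAt.eventually (lt_mem_nhds (h.pos ν hν ξ))

lemma CLTAssumption.hasDerivAt_logLik (h : CLTAssumption μ V S) (ξ : X) {ν : ℝ}
    (hν : 0 < density V ξ ν) :
    HasDerivAt (logLik V ξ) (deriv (density V ξ) ν / density V ξ ν) ν :=
  (h.differentiable_density ξ ν).hasDerivAt.log hν.ne'

lemma CLTAssumption.deriv_logLik (h : CLTAssumption μ V S) (ξ : X) {ν : ℝ} (hν : ν ∈ S) :
    deriv (logLik V ξ) ν = deriv (density V ξ) ν / density V ξ ν :=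
  (h.hasDerivAt_logLik ξ (h.pos ν hν ξ)).deriv

lemma CLTAssumption.hasDerivAt_deriv_logLik (h : CLTAssumption μ V S) (ξ : X) {ν : ℝ}
    (hν : ν ∈ S) :
    HasDerivAt (deriv (logLik V ξ)) (iteratedDeriv 2 (density V ξ) ν / density V ξ ν -
      (deriv (logLik V ξ) ν) ^ 2) ν := by
  have he : deriv (logLik V ξ) =ᶠ[𝓝 ν] fun ν' => deriv (density V ξ) ν' / density V ξ ν' := by
    filter_upwards [h.eventually_pos ξ hν] with ν' h'
    exact (h.hasDerivAt_logLik ξ h').deriv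
  have hp := h.pos ν hν ξ
  have h1 := (h.differentiable_deriv_density ξ ν).hasDerivAt.div
    (h.differentiable_density ξ ν).hasDerivAt hp.ne'
  refine (h1.congr_of_eventuallyEq he).congr_deriv ?_
  rw [h.deriv_logLik ξ hν, iteratedDeriv_succ, iteratedDeriv_one]
  field_simp

lemma CLTAssumption.iteratedDeriv_two_logLik (h : CLTAssumption μ V S) (ξ : X) {ν : ℝ}
    (hν : ν ∈ S) :
    iteratedDeriv 2 (logLik V ξ) ν = iteratedDeriv 2 (density V ξ) ν / density V ξ ν -
      (deriv (logLik V ξ) ν) ^ 2 := by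
  rw [iteratedDeriv_succ, iteratedDeriv_one]
  exact (h.hasDerivAt_deriv_logLik ξ hν).deriv

lemma CLTAssumption.continuousOn_logLik (h : CLTAssumption μ V S) (ξ : X) :
    ContinuousOn (logLik V ξ) S := fun ν hν =>
  (h.hasDerivAt_logLik ξ (h.pos ν hν ξ)).continuousAt.continuousWithinAt

lemma CLTAssumption.continuousOn_iteratedDeriv_two (h : CLTAssumption μ V S) (ξ : X) :
    ContinuousOn (iteratedDeriv 2 (logLik V ξ)) S := by
  refine ContinuousOn.congr (f := fun ν => iteratedDeriv 2 (density V ξ) ν / density V ξ ν -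
      (deriv (logLik V ξ) ν) ^ 2) ?_ fun ν hν => h.iteratedDeriv_two_logLik ξ hν
  have h2 : Continuous (iteratedDeriv 2 (density V ξ)) :=
    (h.contDiff ξ).continuous_iteratedDeriv 2 (by norm_num)
  have hd := (h.differentiable_density ξ).continuous
  refine (h2.continuousOn.div hd.continuousOn fun ν hν => (h.pos ν hν ξ).ne').sub
    (ContinuousOn.pow (fun ν hν => ?_) 2)
  exact (h.hasDerivAt_deriv_logLik ξ hν).continuousAt.continuousWithinAt

lemma CLTAssumption.measurable_deriv_density (h : CLTAssumption μ V S)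
    (hV : IsJumpFamily μ V S) :
    Measurable (Function.uncurry fun ξ ν => deriv (density V ξ) ν) :=
  measurable_deriv_param (F := density V) (measurable_density hV.measurable)
    h.differentiable_density

lemma CLTAssumption.measurable_iteratedDeriv_density (h : CLTAssumption μ V S)
    (hV : IsJumpFamily μ V S) (ν : ℝ) :
    Measurable fun ξ => iteratedDeriv 2 (density V ξ) ν := by
  have h2 : Measurable (Function.uncurry fun ξ ν => deriv (deriv (density V ξ)) ν) :=
    measurable_deriv_param (h.measurable_deriv_density hV) h.differentiable_deriv_density
  have e : (fun ξ => iteratedDeriv 2 (density V ξ) ν) =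
      Function.uncurry (fun ξ ν => deriv (deriv (density V ξ)) ν) ∘ fun ξ => (ξ, ν) := by
    funext ξ
    rw [iteratedDeriv_succ, iteratedDeriv_one, Function.comp_apply, Function.uncurry_apply_pair]
  rw [e]
  exact h2.comp measurable_prodMk_right

lemma IsJumpFamily.measurable_logLik_left (hV : IsJumpFamily μ V S) (ν : ℝ) :
    Measurable fun ξ => logLik V ξ ν :=
  Real.measurable_log.comp (hV.measurable_density_left ν)

lemma CLTAssumption.measurable_score (h : CLTAssumption μ V S)
    (hV : IsJumpFamily μ V S) {ν : ℝ} (hν : ν ∈ S) :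
    Measurable fun ξ => deriv (logLik V ξ) ν := by
  simp only [h.deriv_logLik _ hν]
  exact ((h.measurable_deriv_density hV).comp measurable_prodMk_right).div
    (hV.measurable_density_left ν)

lemma CLTAssumption.measurable_iteratedDeriv_logLik (h : CLTAssumption μ V S)
    (hV : IsJumpFamily μ V S) {ν : ℝ} (hν : ν ∈ S) :
    Measurable fun ξ => iteratedDeriv 2 (logLik V ξ) ν := by
  simp only [h.iteratedDeriv_two_logLik _ hν]
  exact ((h.measurable_iteratedDeriv_density hV ν).div (hV.measurable_density_left ν)).sub
    ((h.measurable_score hV hν).pow_const 2)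

lemma integral_condLaw (hV : IsJumpFamily μ V S) (ν : ℝ) (φ : X → ℝ) :
    ∫ ξ, φ ξ ∂(condLaw μ V ν) = ∫ ξ, density V ξ ν * φ ξ ∂μ := by
  rw [condLaw, integral_withDensity_eq_integral_toReal_smul
    (hV.measurable_density_left ν).ennreal_ofReal (ae_of_all _ fun x => by simp)]
  refine integral_congr_ae (ae_of_all _ fun ξ => ?_)
  dsimp only
  rw [ENNReal.toReal_ofReal (by unfold density; positivity), smul_eq_mul]

lemma integrable_condLaw_iff (hV : IsJumpFamily μ V S) (ν : ℝ) (φ : X → ℝ) :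
    Integrable φ (condLaw μ V ν) ↔ Integrable (fun ξ => density V ξ ν * φ ξ) μ := by
  rw [condLaw, integrable_withDensity_iff_integrable_smul'
    (hV.measurable_density_left ν).ennreal_ofReal (ae_of_all _ fun x => by simp)]
  refine integrable_congr (ae_of_all _ fun ξ => ?_)
  dsimp only
  rw [ENNReal.toReal_ofReal (by unfold density; positivity), smul_eq_mul]

lemma CLTAssumption.integral_score (h : CLTAssumption μ V S) (hV : IsJumpFamily μ V S) {ν : ℝ}
    (hν : ν ∈ S) : ∫ ξ, deriv (logLik V ξ) ν ∂(condLaw μ V ν) = 0 := by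
  rw [integral_condLaw hV, ← (h.deriv_integral ν hν 1 (by simp)).2]
  refine integral_congr_ae (ae_of_all _ fun ξ => ?_)
  have := (h.pos ν hν ξ).ne'
  simp only [h.deriv_logLik ξ hν, iteratedDeriv_one]
  field_simp

lemma CLTAssumption.fisher_eq (h : CLTAssumption μ V S) (hV : IsJumpFamily μ V S) {ν : ℝ}
    (hν : ν ∈ S) :
    ∫ ξ, iteratedDeriv 2 (logLik V ξ) ν ∂(condLaw μ V ν) = -fisher μ V ν := by
  have e : ∀ ξ, density V ξ ν * (iteratedDeriv 2 (density V ξ) ν / density V ξ ν) =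
      iteratedDeriv 2 (density V ξ) ν := fun ξ => by
    have := (h.pos ν hν ξ).ne'
    field_simp
  obtain ⟨hi, h0⟩ := h.deriv_integral ν hν 2 (by simp)
  have h1 : Integrable (fun ξ => iteratedDeriv 2 (density V ξ) ν / density V ξ ν)
      (condLaw μ V ν) := by
    rw [integrable_condLaw_iff hV]
    simpa only [e] using hi
  simp only [h.iteratedDeriv_two_logLik _ hν]
  rw [integral_sub h1 (h.score_memLp ν hν).integrable_sq, integral_condLaw hV]
  simp only [e]
  rw [h0, zero_sub, fisher]

lemma CLTAssumption.fisher_pos (h : CLTAssumption μ V S) (hV : IsJumpFamily μ V S) {ν : ℝ}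
    (hν : ν ∈ S) : 0 < fisher μ V ν := by
  have := h.info_pos ν hν
  rwa [integral_neg, h.fisher_eq hV hν, neg_neg] at this

end Derivatives

section Consistency

variable {X : Type*} [MeasurableSpace X] {μ : Measure X} {V : X → ℝ → ℂ} {S : Set ℝ}

lemma CLTAssumption.abs_logLik_le (h : CLTAssumption μ V S) (hS : IsCompact S) (ξ : X) {ν : ℝ}
    (hν : ν ∈ S) : |logLik V ξ ν| ≤ ⨆ ν' : S, |logLik V ξ ν'| := by
  obtain ⟨C, hC⟩ := hS.exists_bound_of_continuousOn (h.continuousOn_logLik ξ)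
  refine le_ciSup (f := fun ν' : S => |logLik V ξ ν'|) ⟨C, ?_⟩ ⟨ν, hν⟩
  rintro _ ⟨ν', rfl⟩
  exact hC ν' ν'.2

lemma integrable_logLik (hV : IsJumpFamily μ V S) (hL : LLNAssumption μ V S)
    (hC : CLTAssumption μ V S) (hS : IsCompact S) {ν ν' : ℝ} (hν : ν ∈ S) (hν' : ν' ∈ S) :
    Integrable (fun ξ => logLik V ξ ν') (condLaw μ V ν) :=
  (hL.dominated ν hν).mono' (hV.measurable_logLik_left ν').aestronglyMeasurable
    (ae_of_all _ fun ξ => hC.abs_logLik_le hS ξ hν')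

lemma ae_condLaw_iff (hV : IsJumpFamily μ V S) {ν : ℝ} (hpos : ∀ ξ, 0 < density V ξ ν)
    {p : X → Prop} : (∀ᵐ ξ ∂(condLaw μ V ν), p ξ) ↔ ∀ᵐ ξ ∂μ, p ξ := by
  rw [condLaw, ae_withDensity_iff (hV.measurable_density_left ν).ennreal_ofReal]
  simp [hpos]

lemma integral_logLik_lt (hV : IsJumpFamily μ V S) (hL : LLNAssumption μ V S)
    (hC : CLTAssumption μ V S) (hS : IsCompact S) {ν ν' : ℝ} (hν : ν ∈ S) (hν' : ν' ∈ S)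
    (hne : ν' ≠ ν) :
    ∫ ξ, logLik V ξ ν' ∂(condLaw μ V ν) < ∫ ξ, logLik V ξ ν ∂(condLaw μ V ν) := by
  have := hV.isProbabilityMeasure_condLaw hν
  have hpos := hC.pos ν hν
  have hmul : ∀ ξ, density V ξ ν * (density V ξ ν' / density V ξ ν) = density V ξ ν' := fun ξ =>
    mul_div_cancel₀ _ (hpos ξ).ne'
  have hlog : ∀ ξ, Real.log (density V ξ ν' / density V ξ ν) = logLik V ξ ν' - logLik V ξ ν :=
    fun ξ => Real.log_div (hC.pos ν' hν' ξ).ne' (hpos ξ).ne'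
  have hi := integrable_logLik hV hL hC hS hν hν
  have hi' := integrable_logLik hV hL hC hS hν hν'
  have hneg : ∫ ξ, Real.log (density V ξ ν' / density V ξ ν) ∂(condLaw μ V ν) < 0 := by
    refine integral_log_neg (fun ξ => div_pos (hC.pos ν' hν' ξ) (hpos ξ)) ?_ ?_ ?_ fun hone => ?_
    · simpa only [integrable_condLaw_iff hV, hmul] using hL.integrable ν' hν'
    · simp only [hlog]
      exact hi'.sub hi
    · simpa only [integral_condLaw hV, hmul] using hV.normalised ν' hν'
    · refine hL.identifiable ν' hν' ν hν hne ?_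
      filter_upwards [(ae_condLaw_iff hV hpos).1 hone] with ξ hξ
      exact (div_eq_one_iff_eq (hpos ξ).ne').1 hξ
  simp only [hlog, integral_sub hi' hi] at hneg
  exact sub_neg.1 hneg

lemma tendsto_mle_ae (hV : IsJumpFamily μ V S) (hL : LLNAssumption μ V S)
    (hC : CLTAssumption μ V S) (hS : IsCompact S) {est : ℕ → (ℕ → X) → ℝ} (hE : IsMLE V S est)
    {ν : ℝ} (hν : ν ∈ S) :
    ∀ᵐ ω ∂(iidLaw (condLaw μ V ν)), Tendsto (fun k => est k ω) atTop (𝓝 ν) := by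
  have := hV.isProbabilityMeasure_condLaw hν
  have hm : ∀ ν' ∈ S, Measurable fun ξ => logLik V ξ ν' := fun ν' _ => hV.measurable_logLik_left ν'
  have hle : ∀ ξ, ∀ ν' ∈ S, |logLik V ξ ν'| ≤ ⨆ ν'' : S, |logLik V ξ ν''| :=
    fun ξ ν' hν' => hC.abs_logLik_le hS ξ hν'
  have hdom := hL.dominated ν hν
  filter_upwards [tendstoUniformlyOn_sampleMean_ae hS hm hC.continuousOn_logLik hdom hle]
    with ω hω
  exact tendsto_of_tendstoUniformlyOn_of_isStrictMax hS hω
    (continuousOn_integral_of_bound hm hC.continuousOn_logLik hdom hle) hν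
    (fun ν' hν' hne => integral_logLik_lt hV hL hC hS hν hν' hne) (fun k => hE.mem k ω)
    fun k => hE.isMax k ω ν hν

end Consistency

section Slutsky

variable {Ω Ω' : Type*} [MeasurableSpace Ω] [MeasurableSpace Ω'] {P : Measure Ω}
  [IsProbabilityMeasure P] {P' : Measure Ω'} [IsProbabilityMeasure P']

lemma tendstoInDistribution_of_eventually_eq_mul {Z W : ℕ → Ω → ℝ} {Y : Ω' → ℝ} {c : ℝ}
    (hc : c ≠ 0) (hZ : TendstoInDistribution Z atTop Y (fun _ => P) P')
    (hW : ∀ k, AEMeasurable (W k) P)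
    (hJ : ∀ᵐ ω ∂P, ∃ J : ℕ → ℝ, Tendsto J atTop (𝓝 c) ∧ ∀ᶠ k in atTop, Z k ω = J k * W k ω) :
    TendstoInDistribution W atTop (fun ω => Y ω * c⁻¹) (fun _ => P) P' := by
  classical
  -- `J` need not be measurable in `ω`, so it is replaced by the quotient of `Z` and `W`.
  let R : ℕ → Ω → ℝ := fun k ω => if Z k ω = 0 then c⁻¹ else W k ω / Z k ω
  have hRm : ∀ k, AEMeasurable (R k) P := fun k =>
    (Measurable.ite (p := fun q : ℝ × ℝ => q.1 = 0) (measurableSet_eq_fun measurable_fst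
      measurable_const) measurable_const (measurable_snd.div measurable_fst)).comp_aemeasurable
      ((hZ.forall_aemeasurable k).prodMk (hW k))
  have hR : ∀ᵐ ω ∂P, Tendsto (fun k => R k ω) atTop (𝓝 c⁻¹) := by
    filter_upwards [hJ] with ω ⟨J, hJc, hZJ⟩
    refine (tendsto_const_nhds.if' (hJc.inv₀ hc)).congr' (f₁ := fun k =>
      if Z k ω = 0 then c⁻¹ else (J k)⁻¹) ?_
    filter_upwards [hZJ] with k hk
    refine if_ctx_congr Iff.rfl (fun _ => rfl) fun hZk => ?_
    have hWk : W k ω ≠ 0 := fun h => hZk (by rw [hk, h, mul_zero])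
    rw [hk, div_mul_cancel_right₀ hWk]
  have hRZ : ∀ᵐ ω ∂P, ∀ᶠ k in atTop, W k ω = Z k ω * R k ω := by
    filter_upwards [hJ] with ω ⟨J, hJc, hZJ⟩
    filter_upwards [hZJ, hJc.eventually_ne hc] with k hk hJk
    by_cases hZk : Z k ω = 0
    · have hWk : W k ω = 0 := (mul_eq_zero.1 (hk.symm.trans hZk)).resolve_left hJk
      rw [hWk, hZk, zero_mul]
    · simp only [R, if_neg hZk, mul_div_cancel₀ _ hZk]
  have hlim := hZ.continuous_comp_prodMk_of_tendstoInMeasure_const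
    (g := fun p : ℝ × ℝ => p.1 * p.2) (by fun_prop)
    (tendstoInMeasure_of_tendsto_ae (fun k => (hRm k).aestronglyMeasurable) hR) hRm
  refine tendstoInDistribution_of_tendstoInMeasure_sub _ _ hlim
    (tendstoInMeasure_of_tendsto_ae (fun k => ((hW k).sub
      ((hZ.forall_aemeasurable k).mul (hRm k))).aestronglyMeasurable) ?_) hW
  filter_upwards [hRZ] with ω hω
  refine tendsto_const_nhds.congr' ?_
  filter_upwards [hω] with k hk
  exact (sub_eq_zero.2 hk).symm

end Slutsky

section CentralLimit

variable {X : Type*} [MeasurableSpace X] {Q : Measure X} [IsProbabilityMeasure Q]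

lemma tendstoInDistribution_sqrt_mul_sampleMean {Ω' : Type*} [MeasurableSpace Ω']
    {P' : Measure Ω'} [IsProbabilityMeasure P'] {Y : Ω' → ℝ} {h : X → ℝ} (hm : Measurable h)
    (h2 : MemLp h 2 Q) (h0 : ∫ ξ, h ξ ∂Q = 0)
    (hY : HasLaw Y (gaussianReal 0 Var[h; Q].toNNReal) P') :
    TendstoInDistribution (fun (k : ℕ) ω => Real.sqrt k * sampleMean h k ω) atTop Y
      (fun _ => iidLaw Q) P' := by
  have hlaw := identDistrib_iidLaw (Q := Q) hm
  rw [← (hlaw 0).variance_eq] at hY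
  have hclt := tendstoInDistribution_inv_sqrt_mul_sum_sub
    (X := fun (i : ℕ) (ω : ℕ → X) => h (ω i)) hY ((hlaw 0).memLp_iff.2 h2)
    (iIndepFun_iidLaw hm) fun i => (hlaw i).trans (hlaw 0).symm
  rw [(hlaw 0).integral_eq, h0] at hclt
  simp only [mul_zero, sub_zero] at hclt
  have hsqrt : ∀ k : ℕ, Real.sqrt k * (1 / (k : ℝ)) = (Real.sqrt k)⁻¹ := fun k => by
    rw [mul_one_div, Real.sqrt_div_self', one_div]
  simpa only [sampleMean, ← mul_assoc, hsqrt] using hclt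

end CentralLimit

section LikelihoodEquation

lemma exists_mem_uIcc_deriv_eq_of_isMaxOn {B : Set ℝ} (hB : Convex ℝ B) (hBo : IsOpen B)
    {L L' L'' : ℝ → ℝ} (hL : ∀ x ∈ B, HasDerivAt L (L' x) x)
    (hL' : ∀ x ∈ B, HasDerivAt L' (L'' x) x) {a b : ℝ} (ha : a ∈ B) (hb : b ∈ B)
    (hmax : IsMaxOn L B b) : ∃ c ∈ Set.uIcc a b, L' a = -L'' c * (b - a) := by
  have hzero : L' b = 0 := (hmax.isLocalMax (hBo.mem_nhds hb)).hasDerivAt_eq_zero (hL b hb)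
  obtain ⟨c, hc, hmean⟩ := domain_mvt
    (fun x hx => (hL' x hx).hasFDerivAt.hasFDerivWithinAt) hB ha hb
  refine ⟨c, segment_eq_uIcc a b ▸ hc, ?_⟩
  rw [ContinuousLinearMap.toSpanSingleton_apply, smul_eq_mul] at hmean
  linarith

lemma hasDerivAt_sampleMean {X : Type*} {h h' : X → ℝ → ℝ} {t : ℝ}
    (hd : ∀ ξ, HasDerivAt (h ξ) (h' ξ t) t) (k : ℕ) (ω : ℕ → X) :
    HasDerivAt (fun t => sampleMean (fun ξ => h ξ t) k ω) (sampleMean (fun ξ => h' ξ t) k ω) t :=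
  (HasDerivAt.fun_sum fun j _ => hd (ω j)).const_mul _

variable {X : Type*} [MeasurableSpace X] {μ : Measure X} {V : X → ℝ → ℂ} {S : Set ℝ}
  {est : ℕ → (ℕ → X) → ℝ}

lemma IsMLE.exists_sampleMean_score_eq (hE : IsMLE V S est) (hC : CLTAssumption μ V S)
    {B : Set ℝ} (hB : Convex ℝ B) (hBo : IsOpen B) (hBS : B ⊆ S) {ν : ℝ} (hν : ν ∈ B) {k : ℕ}
    {ω : ℕ → X} (hest : est k ω ∈ B) :
    ∃ ν' ∈ Set.uIcc ν (est k ω), sampleMean (fun ξ => deriv (logLik V ξ) ν) k ω =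
      -sampleMean (fun ξ => iteratedDeriv 2 (logLik V ξ) ν') k ω * (est k ω - ν) := by
  refine exists_mem_uIcc_deriv_eq_of_isMaxOn hB hBo (L := logLikAvg V k ω)
    (L' := fun t => sampleMean (fun ξ => deriv (logLik V ξ) t) k ω)
    (L'' := fun t => sampleMean (fun ξ => iteratedDeriv 2 (logLik V ξ) t) k ω)
    (fun t ht => ?_) (fun t ht => ?_) hν hest fun t ht => hE.isMax k ω t (hBS ht)
  · exact hasDerivAt_sampleMean (h := logLik V) (h' := fun ξ => deriv (logLik V ξ))
      (fun ξ => (hC.hasDerivAt_logLik ξ (hC.pos t (hBS ht) ξ)).differentiableAt.hasDerivAt) k ω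
  · refine hasDerivAt_sampleMean (h := fun ξ => deriv (logLik V ξ))
      (h' := fun ξ => iteratedDeriv 2 (logLik V ξ)) (fun ξ => ?_) k ω
    rw [hC.iteratedDeriv_two_logLik ξ (hBS ht)]
    exact hC.hasDerivAt_deriv_logLik ξ (hBS ht)

lemma exists_tendsto_fisher_and_score_eq_ae (hV : IsJumpFamily μ V S) (hL : LLNAssumption μ V S)
    (hC : CLTAssumption μ V S) (hS : IsCompact S) (hE : IsMLE V S est) {ν : ℝ}
    (hν : ν ∈ interior S) :
    ∀ᵐ ω ∂(iidLaw (condLaw μ V ν)), ∃ J : ℕ → ℝ, Tendsto J atTop (𝓝 (fisher μ V ν)) ∧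
      ∀ᶠ k in atTop,
        sampleMean (fun ξ => deriv (logLik V ξ) ν) k ω = J k * (est k ω - ν) := by
  have hνS := interior_subset hν
  have := hV.isProbabilityMeasure_condLaw hνS
  obtain ⟨r, hr, hball⟩ := Metric.mem_nhds_iff.1 (mem_interior_iff_mem_nhds.1 hν)
  obtain ⟨g, hg, hbound⟩ := hC.dominated ν hνS
  have hle : ∀ ξ, ∀ ν' ∈ S, |iteratedDeriv 2 (logLik V ξ) ν'| ≤ g ξ :=
    fun ξ ν' hν' => (hbound 2 (by simp) ξ ν' hν').le
  have hm : ∀ ν' ∈ S, Measurable fun ξ => iteratedDeriv 2 (logLik V ξ) ν' :=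
    fun ν' hν' => hC.measurable_iteratedDeriv_logLik hV hν'
  filter_upwards [tendsto_mle_ae hV hL hC hS hE hνS, tendsto_sampleMean_comp_ae hS
    (h := fun ξ => iteratedDeriv 2 (logLik V ξ)) hm hC.continuousOn_iteratedDeriv_two hg hle hνS]
    with ω hcons hlln
  have hmean : ∀ᶠ k in atTop, ∃ ν' ∈ Set.uIcc ν (est k ω),
      sampleMean (fun ξ => deriv (logLik V ξ) ν) k ω =
        -sampleMean (fun ξ => iteratedDeriv 2 (logLik V ξ) ν') k ω * (est k ω - ν) := by
    filter_upwards [hcons.eventually (Metric.ball_mem_nhds ν hr)] with k hk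
    exact hE.exists_sampleMean_score_eq hC (convex_ball ν r) Metric.isOpen_ball hball
      (Metric.mem_ball_self hr) hk
  obtain ⟨c, hc⟩ := hmean.choice
  have hcν : Tendsto c atTop (𝓝 ν) := by
    refine tendsto_iff_dist_tendsto_zero.2 (squeeze_zero' (Eventually.of_forall fun _ =>
      dist_nonneg) ?_ (tendsto_iff_dist_tendsto_zero.1 hcons))
    filter_upwards [hc] with k hk
    exact Set.abs_sub_left_of_mem_uIcc hk.1
  have hcS : ∀ᶠ k in atTop, c k ∈ S := hcν.eventually (mem_interior_iff_mem_nhds.1 hν)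
  refine ⟨fun k => -sampleMean (fun ξ => iteratedDeriv 2 (logLik V ξ) (c k)) k ω, ?_,
    hc.mono fun k hk => hk.2⟩
  rw [← neg_neg (fisher μ V ν), ← hC.fisher_eq hV hνS]
  exact (hlln c (tendsto_nhdsWithin_iff.2 ⟨hcν, hcS⟩)).neg

end LikelihoodEquation

section AsymptoticNormality

variable {X : Type*} [MeasurableSpace X] {μ : Measure X} {V : X → ℝ → ℂ} {S : Set ℝ}

instance instIsProbabilityMeasureLimitNormal (ν : ℝ) :
    IsProbabilityMeasure (limitNormal μ V ν) := by
  unfold limitNormal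
  infer_instance

lemma hasLaw_mul_fisher {ν : ℝ} (hF : 0 < fisher μ V ν) :
    HasLaw (fun x => x * fisher μ V ν) (gaussianReal 0 (fisher μ V ν).toNNReal)
      (limitNormal μ V ν) := by
  refine ⟨by fun_prop, ?_⟩
  rw [limitNormal, gaussianReal_map_mul_const, mul_zero]
  congr 1
  ext
  push_cast
  rw [Real.coe_toNNReal _ (inv_nonneg.2 hF.le), Real.coe_toNNReal _ hF.le]
  field_simp

lemma CLTAssumption.variance_score (hC : CLTAssumption μ V S) (hV : IsJumpFamily μ V S) {ν : ℝ}
    (hν : ν ∈ S) : Var[fun ξ => deriv (logLik V ξ) ν; condLaw μ V ν] = fisher μ V ν :=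
  variance_of_integral_eq_zero (hC.measurable_score hV hν).aemeasurable
    (hC.integral_score hV hν)

lemma tendstoInDistribution_mle (hV : IsJumpFamily μ V S) (hL : LLNAssumption μ V S)
    (hC : CLTAssumption μ V S) (hS : IsCompact S) {est : ℕ → (ℕ → X) → ℝ} (hE : IsMLE V S est)
    {ν : ℝ} (hν : ν ∈ interior S) [IsProbabilityMeasure (condLaw μ V ν)] :
    TendstoInDistribution (fun (k : ℕ) ω => Real.sqrt k * (est k ω - ν)) atTop (id : ℝ → ℝ)
      (fun _ => iidLaw (condLaw μ V ν)) (limitNormal μ V ν) := by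
  have hνS := interior_subset hν
  have hF := hC.fisher_pos hV hνS
  have hscore : TendstoInDistribution
      (fun (k : ℕ) ω => Real.sqrt k * sampleMean (fun ξ => deriv (logLik V ξ) ν) k ω) atTop
      (fun x => x * fisher μ V ν) (fun _ => iidLaw (condLaw μ V ν)) (limitNormal μ V ν) :=
    tendstoInDistribution_sqrt_mul_sampleMean (hC.measurable_score hV hνS)
      (hC.score_memLp ν hνS) (hC.integral_score hV hνS)
      ((hC.variance_score hV hνS).symm ▸ hasLaw_mul_fisher hF)
  have hlim := tendstoInDistribution_of_eventually_eq_mul hF.ne' hscore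
    (W := fun (k : ℕ) ω => Real.sqrt k * (est k ω - ν))
    (fun k => (((hE.measurable k).sub_const ν).const_mul _).aemeasurable) ?_
  · simp only [mul_inv_cancel_right₀ hF.ne'] at hlim
    exact hlim
  · filter_upwards [exists_tendsto_fisher_and_score_eq_ae hV hL hC hS hE hν] with ω ⟨J, hJ, hscore⟩
    refine ⟨J, hJ, hscore.mono fun k hk => ?_⟩
    rw [hk, mul_left_comm]

end AsymptoticNormality

section Mixture

variable {α Ω : Type*} [MeasurableSpace α] [MeasurableSpace Ω] {m : Measure α}
  {κ : α → Measure Ω}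

lemma ae_bind_of_ae_ae (hκ : AEMeasurable κ m) {p : Ω → Prop} (hp : MeasurableSet {ω | p ω})
    (h : ∀ᵐ a ∂m, ∀ᵐ ω ∂κ a, p ω) : ∀ᵐ ω ∂m.bind κ, p ω := by
  refine (Measure.bind_apply hp.compl hκ).trans ?_
  exact lintegral_eq_zero_of_ae_eq_zero (h.mono fun a ha => ae_iff.1 ha)

lemma map_bind_eq_self (hκ : AEMeasurable κ m) (hprob : ∀ᵐ a ∂m, IsProbabilityMeasure (κ a))
    {f : Ω → α} (hf : Measurable f) (h : ∀ᵐ a ∂m, ∀ᵐ ω ∂κ a, f ω = a) :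
    (m.bind κ).map f = m := by
  ext s hs
  rw [Measure.map_apply hf hs, Measure.bind_apply (hf hs) hκ, ← lintegral_indicator_one hs]
  refine lintegral_congr_ae ?_
  filter_upwards [hprob, h] with a hprob ha
  have hmap : (κ a).map f = Measure.dirac a := by
    rw [Measure.map_congr ha, Measure.map_const, measure_univ, one_smul]
  rw [← Measure.map_apply hf hs, hmap, Measure.dirac_apply' a hs]

lemma tendstoInDistribution_bind {ι E : Type*} {l : Filter ι} [l.IsCountablyGenerated]
    [TopologicalSpace E] [MeasurableSpace E] [OpensMeasurableSpace E] (hκ : Measurable κ)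
    {η : α → Measure E} (hη : AEMeasurable η m) [∀ a, IsProbabilityMeasure (η a)]
    [IsProbabilityMeasure m] [IsProbabilityMeasure (m.bind κ)] [IsProbabilityMeasure (m.bind η)]
    {W : ι → Ω → E} (hW : ∀ k, Measurable (W k))
    (h : ∀ᵐ a ∂m, ∃ _ : IsProbabilityMeasure (κ a),
      TendstoInDistribution W l id (fun _ => κ a) (η a)) :
    TendstoInDistribution W l id (fun _ => m.bind κ) (m.bind η) := by
  refine ⟨fun k => (hW k).aemeasurable, aemeasurable_id,
    ProbabilityMeasure.tendsto_iff_forall_lintegral_tendsto.2 fun f => ?_⟩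
  have hf : Measurable fun x => (f x : ℝ≥0∞) := f.continuous.measurable.coe_nnreal_ennreal
  simp only [ProbabilityMeasure.coe_mk, Measure.map_id, lintegral_map hf (hW _),
    Measure.lintegral_bind hη hf.aemeasurable]
  simp only [Measure.lintegral_bind (f := fun ω => (f (W _ ω) : ℝ≥0∞)) hκ.aemeasurable
    (hf.comp (hW _)).aemeasurable]
  refine tendsto_lintegral_filter_of_dominated_convergence (fun _ => (nndist 0 f : ℝ≥0∞))
    (Eventually.of_forall fun k =>
      (Measure.measurable_lintegral (hf.comp (hW k))).comp hκ)
    (Eventually.of_forall fun k => ?_) (by simp) ?_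
  · filter_upwards [h] with a ⟨_, _⟩
    calc ∫⁻ ω, f (W k ω) ∂κ a ≤ ∫⁻ _, nndist 0 f ∂κ a :=
          lintegral_mono fun ω => ENNReal.coe_le_coe.2 (f.apply_le_nndist_zero _)
      _ = nndist 0 f := by rw [lintegral_const, measure_univ, mul_one]
  · filter_upwards [h] with a ⟨_, ha⟩
    simpa only [ProbabilityMeasure.coe_mk, Measure.map_id, lintegral_map hf (hW _)] using
      ProbabilityMeasure.tendsto_iff_forall_lintegral_tendsto.1 ha.tendsto f

lemma tendsto_measureReal_le_of_tendstoInDistribution {ι : Type*} {l : Filter ι} {P : Measure Ω}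
    [IsProbabilityMeasure P] {η : Measure ℝ} [IsProbabilityMeasure η] {W : ι → Ω → ℝ}
    (h : TendstoInDistribution W l id (fun _ => P) η) {a : ℝ} (ha : η {a} = 0) :
    Tendsto (fun k => P.real {ω | W k ω ≤ a}) l (𝓝 (η.real (Set.Iic a))) := by
  have hfrontier : η.map id (frontier (Set.Iic a)) = 0 := by
    rw [frontier_Iic, Measure.map_id, ha]
  have hlim := (ENNReal.tendsto_toReal (measure_ne_top (η.map id) _)).comp
    (ProbabilityMeasure.tendsto_measure_of_null_frontier_of_tendsto' h.tendsto hfrontier)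
  simp only [ProbabilityMeasure.coe_mk, Measure.map_id] at hlim
  refine hlim.congr fun k => ?_
  simp only [Function.comp_apply, Measure.map_apply_of_aemeasurable (h.forall_aemeasurable k)
    measurableSet_Iic]
  rfl

end Mixture

section RandomParameter

variable {X : Type*} [MeasurableSpace X] {μ : Measure X} {V : X → ℝ → ℂ} {S : Set ℝ}
  {m : Measure ℝ}

lemma aemeasurable_limitNormal [SFinite μ] (hV : IsJumpFamily μ V S) (hC : CLTAssumption μ V S)
    (hm : ∀ᵐ ν ∂m, ν ∈ S) : AEMeasurable (limitNormal μ V) m := by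
  let φ : X → ℝ → ℝ := fun ξ ν =>
    density V ξ ν * (deriv (density V ξ) ν / density V ξ ν) ^ 2
  have hf := measurable_density hV.measurable
  have hφ : Measurable (Function.uncurry φ) :=
    hf.mul (((hC.measurable_deriv_density hV).div hf).pow_const 2)
  have hint : Measurable fun ν => ∫ ξ, φ ξ ν ∂μ :=
    hφ.stronglyMeasurable.integral_prod_left'.measurable
  refine ⟨fun ν => gaussianReal 0 (Real.toNNReal (∫ ξ, φ ξ ν ∂μ)⁻¹),
    measurable_gaussianReal.comp (measurable_const.prodMk hint.inv.real_toNNReal), ?_⟩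
  filter_upwards [hm] with ν hν
  rw [limitNormal, fisher, integral_condLaw hV]
  simp only [hC.deriv_logLik _ hν, φ]

lemma bind_limitNormal_singleton [SFinite μ] (hV : IsJumpFamily μ V S)
    (hC : CLTAssumption μ V S) (hm : ∀ᵐ ν ∂m, ν ∈ S) (a : ℝ) :
    m.bind (limitNormal μ V) {a} = 0 := by
  rw [Measure.bind_apply (measurableSet_singleton a) (aemeasurable_limitNormal hV hC hm)]
  refine lintegral_eq_zero_of_ae_eq_zero ?_
  filter_upwards [hm] with ν hν
  have : NullSingletonClass (limitNormal μ V ν) :=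
    nullSingletonClass_gaussianReal (by simpa using hC.fisher_pos hV hν)
  exact measure_singleton a

lemma measureReal_bind_limitNormal [SFinite μ] (hV : IsJumpFamily μ V S)
    (hC : CLTAssumption μ V S) (hm : ∀ᵐ ν ∂m, ν ∈ S) {s : Set ℝ} (hs : MeasurableSet s) :
    (m.bind (limitNormal μ V)).real s = ∫ ν in S, (limitNormal μ V ν).real s ∂m := by
  have hη := aemeasurable_limitNormal hV hC hm
  rw [Measure.restrict_eq_self_of_ae_mem hm, measureReal_def, Measure.bind_apply hs hη]
  exact (integral_toReal ((Measure.measurable_coe hs).comp_aemeasurable hη)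
    (ae_of_all _ fun ν => measure_lt_top _ _)).symm

/-- The almost sure limit of the estimators. The upper limit makes it defined everywhere and
measurable. -/
def mleLimit (est : ℕ → (ℕ → X) → ℝ) (ω : ℕ → X) : ℝ := limsup (fun k => est k ω) atTop

variable {est : ℕ → (ℕ → X) → ℝ}

lemma IsMLE.measurable_mleLimit (hE : IsMLE V S est) : Measurable (mleLimit est) :=
  Measurable.limsup hE.measurable

lemma mleLimit_eq_ae (hV : IsJumpFamily μ V S) (hL : LLNAssumption μ V S)
    (hC : CLTAssumption μ V S) (hS : IsCompact S) (hE : IsMLE V S est) {ν : ℝ} (hν : ν ∈ S) :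
    ∀ᵐ ω ∂(iidLaw (condLaw μ V ν)), mleLimit est ω = ν :=
  (tendsto_mle_ae hV hL hC hS hE hν).mono fun _ hω => hω.limsup_eq

lemma tendsto_mleLimit_ae_bind [SFinite μ] (hV : IsJumpFamily μ V S) (hL : LLNAssumption μ V S)
    (hC : CLTAssumption μ V S) (hS : IsCompact S) (hE : IsMLE V S est)
    (hm : ∀ᵐ ν ∂m, ν ∈ S) :
    ∀ᵐ ω ∂(m.bind fun ν => iidLaw (condLaw μ V ν)),
      Tendsto (fun k => est k ω) atTop (𝓝 (mleLimit est ω)) := by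
  refine ae_bind_of_ae_ae (measurable_iidLaw_condLaw hV.measurable).aemeasurable
    (measurableSet_tendsto_fun hE.measurable hE.measurable_mleLimit) ?_
  filter_upwards [hm] with ν hν
  filter_upwards [tendsto_mle_ae hV hL hC hS hE hν, mleLimit_eq_ae hV hL hC hS hE hν]
    with ω hconv hlimit
  rwa [hlimit]

lemma map_mleLimit_bind [SFinite μ] (hV : IsJumpFamily μ V S) (hL : LLNAssumption μ V S)
    (hC : CLTAssumption μ V S) (hS : IsCompact S) (hE : IsMLE V S est)
    (hm : ∀ᵐ ν ∂m, ν ∈ S) :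
    (m.bind fun ν => iidLaw (condLaw μ V ν)).map (mleLimit est) = m := by
  refine map_bind_eq_self (measurable_iidLaw_condLaw hV.measurable).aemeasurable ?_
    hE.measurable_mleLimit (hm.mono fun ν hν => mleLimit_eq_ae hV hL hC hS hE hν)
  filter_upwards [hm] with ν hν
  have := hV.isProbabilityMeasure_condLaw hν
  infer_instance

lemma tendstoInDistribution_mle_sub_mleLimit (hV : IsJumpFamily μ V S)
    (hL : LLNAssumption μ V S) (hC : CLTAssumption μ V S) (hS : IsCompact S) (hE : IsMLE V S est)
    {ν : ℝ} (hν : ν ∈ interior S) [IsProbabilityMeasure (condLaw μ V ν)] :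
    TendstoInDistribution (fun (k : ℕ) ω => Real.sqrt k * (est k ω - mleLimit est ω)) atTop
      (id : ℝ → ℝ) (fun _ => iidLaw (condLaw μ V ν)) (limitNormal μ V ν) := by
  refine (tendstoInDistribution_mle hV hL hC hS hE hν).congr (fun k => ?_) (ae_eq_refl _)
  filter_upwards [mleLimit_eq_ae hV hL hC hS hE (interior_subset hν)] with ω hω
  rw [hω]

lemma tendstoInDistribution_mle_bind [SFinite μ] (hV : IsJumpFamily μ V S)
    (hL : LLNAssumption μ V S) (hC : CLTAssumption μ V S) (hS : IsCompact S) (hE : IsMLE V S est)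
    (hm : ∀ᵐ ν ∂m, ν ∈ S) (hbd : m (frontier S) = 0) [IsProbabilityMeasure m]
    [IsProbabilityMeasure (m.bind fun ν => iidLaw (condLaw μ V ν))]
    [IsProbabilityMeasure (m.bind (limitNormal μ V))] :
    TendstoInDistribution (fun (k : ℕ) ω => Real.sqrt k * (est k ω - mleLimit est ω)) atTop
      (id : ℝ → ℝ) (fun _ => m.bind fun ν => iidLaw (condLaw μ V ν))
      (m.bind (limitNormal μ V)) := by
  refine tendstoInDistribution_bind (measurable_iidLaw_condLaw hV.measurable)
    (aemeasurable_limitNormal hV hC hm)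
    (fun k => ((hE.measurable k).sub hE.measurable_mleLimit).const_mul _) ?_
  filter_upwards [hm, measure_eq_zero_iff_ae_notMem.1 hbd] with ν hν hfrontier
  have hint : ν ∈ interior S := by_contra fun h => hfrontier ⟨subset_closure hν, h⟩
  have := hV.isProbabilityMeasure_condLaw hν
  exact ⟨inferInstance, tendstoInDistribution_mle_sub_mleLimit hV hL hC hS hE hint⟩

end RandomParameter

end

end NonDemolition

open NonDemolition in
theorem theorem2p3_general
    {H : Type*} [NormedAddCommGroup H] [InnerProductSpace ℂ H] [CompleteSpace H]
    {X : Type*} [MeasurableSpace X] (μ : Measure X)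
    (N : H →L[ℂ] H) (hN : IsSelfAdjoint N) (ρ : H →L[ℂ] H) (hρ : IsDensityMatrix ρ)
    (V : X → ℝ → ℂ) (hV : IsJumpFamily μ V (spectrum ℝ N))
    (hLLN : LLNAssumption μ V (spectrum ℝ N)) (hCLT : CLTAssumption μ V (spectrum ℝ N))
    (hbd : spectralMeasure N ρ (frontier (spectrum ℝ N)) = 0)
    (Nhat : ℕ → (ℕ → X) → ℝ) (hMLE : IsMLE V (spectrum ℝ N) Nhat) :
    ∃ Ninf : (ℕ → X) → ℝ, Measurable Ninf ∧
      (∀ᵐ ω ∂(outcomeLaw μ N V ρ), Tendsto (fun k => Nhat k ω) atTop (𝓝 (Ninf ω))) ∧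
      (outcomeLaw μ N V ρ).map Ninf = spectralMeasure N ρ ∧
      (∃ (_ : IsProbabilityMeasure (outcomeLaw μ N V ρ))
        (_ : IsProbabilityMeasure ((spectralMeasure N ρ).bind (limitNormal μ V))),
        TendstoInDistribution (fun (k : ℕ) ω => Real.sqrt k * (Nhat k ω - Ninf ω)) atTop
          (id : ℝ → ℝ) (fun _ => outcomeLaw μ N V ρ)
          ((spectralMeasure N ρ).bind (limitNormal μ V))) ∧
      (∀ a : ℝ, Tendsto
        (fun k : ℕ => (outcomeLaw μ N V ρ).real {ω | Real.sqrt k * (Nhat k ω - Ninf ω) ≤ a})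
        atTop (𝓝 (∫ ν in spectrum ℝ N, (limitNormal μ V ν).real (Set.Iic a)
          ∂(spectralMeasure N ρ)))) := by
  have hS := spectrum.isCompact (𝕜 := ℝ) N
  have hmem := spectralMeasure_ae_mem hN hρ
  have := isProbabilityMeasure_spectralMeasure hN hρ
  obtain ⟨ν, hν⟩ := hmem.exists
  have := hV.sigmaFinite hν (hCLT.pos ν hν)
  have := isProbabilityMeasure_bind (aemeasurable_limitNormal hV hCLT hmem)
    (ae_of_all _ fun ν => inferInstance)
  have := hV.isProbabilityMeasure_bind_iidLaw hmem
  rw [outcomeLaw_eq_bind hN hρ hV]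
  have hdist := tendstoInDistribution_mle_bind hV hLLN hCLT hS hMLE hmem hbd
  refine ⟨mleLimit Nhat, hMLE.measurable_mleLimit,
    tendsto_mleLimit_ae_bind hV hLLN hCLT hS hMLE hmem,
    map_mleLimit_bind hV hLLN hCLT hS hMLE hmem, ⟨inferInstance, inferInstance, hdist⟩,
    fun a => ?_⟩
  rw [← measureReal_bind_limitNormal hV hCLT hmem measurableSet_Iic]
  exact tendsto_measureReal_le_of_tendstoInDistribution hdist
    (bind_limitNormal_singleton hV hCLT hmem a)

theorem theorem2p3
    {H : Type*} [NormedAddCommGroup H] [InnerProductSpace ℂ H] [CompleteSpace H]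
    [TopologicalSpace.SeparableSpace H]
    {X : Type*} [MeasurableSpace X] (μ : Measure X) [SigmaFinite μ]
    (N : H →L[ℂ] H) (hN : IsSelfAdjoint N)
    (ρ : H →L[ℂ] H) (hρ : NonDemolition.IsDensityMatrix ρ)
    (V : X → ℝ → ℂ) (hV : NonDemolition.IsJumpFamily μ V (spectrum ℝ N))
    (hLLN : NonDemolition.LLNAssumption μ V (spectrum ℝ N))
    (hCLT : NonDemolition.CLTAssumption μ V (spectrum ℝ N))
    (hbd : NonDemolition.spectralMeasure N ρ (frontier (spectrum ℝ N)) = 0)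
    (Nhat : ℕ → (ℕ → X) → ℝ) (hMLE : NonDemolition.IsMLE V (spectrum ℝ N) Nhat) :
    ∃ Ninf : (ℕ → X) → ℝ, Measurable Ninf ∧
      -- `Ninf` is the almost sure limit of the estimators, with law `λ_ρ`
      (∀ᵐ ω ∂(NonDemolition.outcomeLaw μ N V ρ),
        Tendsto (fun k => Nhat k ω) atTop (𝓝 (Ninf ω))) ∧
      (NonDemolition.outcomeLaw μ N V ρ).map Ninf = NonDemolition.spectralMeasure N ρ ∧
      -- convergence in distribution to the mixture of the laws `N(0, F(ν)⁻¹)`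
      (∃ (_ : IsProbabilityMeasure (NonDemolition.outcomeLaw μ N V ρ))
        (_ : IsProbabilityMeasure
          ((NonDemolition.spectralMeasure N ρ).bind (NonDemolition.limitNormal μ V))),
        TendstoInDistribution (fun (k : ℕ) ω => Real.sqrt k * (Nhat k ω - Ninf ω)) atTop
          (id : ℝ → ℝ) (fun _ => NonDemolition.outcomeLaw μ N V ρ)
          ((NonDemolition.spectralMeasure N ρ).bind (NonDemolition.limitNormal μ V))) ∧
      -- convergence of the distribution functions
      (∀ a : ℝ, Tendsto
        (fun k : ℕ => (NonDemolition.outcomeLaw μ N V ρ).real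
          {ω | Real.sqrt k * (Nhat k ω - Ninf ω) ≤ a}) atTop
        (𝓝 (∫ ν in spectrum ℝ N, (NonDemolition.limitNormal μ V ν).real (Set.Iic a)
          ∂(NonDemolition.spectralMeasure N ρ)))) :=
  theorem2p3_general μ N hN ρ hρ V hV hLLN hCLT hbd Nhat hMLE
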